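/- Let $N\ge 1$, let $D\subset\mathbb{R}^N$ be compact, let $m>0$, and let $C_m(D)$ be the class of open convex sets $\Omega\subset D$ with Lebesgue measure $|\Omega|=m$. A sequence $(\Omega_n)$ in $C_m(D)$ converges uniformly to $\Omega\in C_m(D)$ if for every $\epsilon>0$ one has $\Omega_n\subset\Omega+B(\epsilon)$ and $\Omega\subset\Omega_n+B(\epsilon)$ for all sufficiently large $n$, where $B(\epsilon)$ is the open ball of radius $\epsilon$ centred at the origin (equivalently, $\Omega_n\to\Omega$ in the Hausdorff distance). Let $(a_{ij})$ be a constant, symmetric, positive definite real $N\times N$ matrix. A real number $\lambda$ is a Dirichlet eigenvalue of $-\partial_i(a_{ij}\partial_j\,\cdot)$ on $\Omega$ if there is a nonzero $u\in H^1_0(\Omega)$ with $$\int_\Omega \sum_{i,j}a_{ij}\,\partial_j u\,\partial_i v\,dx=\lambda\int_\Omega u\,v\,dx\qquad\text{for all } v\in H^1_0(\Omega).$$ For $k\ge1$ let $\lambda_k(\Omega)$ be the $k$-th eigenvalue when the eigenvalues are listed in increasing order and repeated according to multiplicity; that is, the least real $t$ for which there are $k$ linearly independent eigenfunctions with eigenvalues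 at most $t$. Then for every integer $k\ge1$ the functional $\lambda_k$ is well defined and real-valued on $C_m(D)$ (the least $t$ exists), it is bounded on $C_m(D)$, and it is continuous: if $\Omega_n,\Omega\in C_m(D)$ and $\Omega_n\to\Omega$ uniformly, then $\lambda_k(\Omega_n)\to\lambda_k(\Omega)$. -/

import Mathlib

open MeasureTheory Filter Topology
open scoped ContDiff Pointwise Gradient

noncomputable section

/-- The class of open convex sets contained in `D` with Lebesgue measure `m`. -/
def convexClass {N : ℕ} (D : Set (EuclideanSpace ℝ (Fin N))) (m : ℝ) :
    Set (Set (EuclideanSpace ℝ (Fin N))) :=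
  {Ω | Ω ⊆ D ∧ IsOpen Ω ∧ Convex ℝ Ω ∧ volume Ω = ENNReal.ofReal m}

/-- Uniform (Hausdorff) convergence of a sequence of sets: for every `ε > 0`, eventually each of
the two sets is contained in the `ε`-enlargement of the other. -/
def UniformlyConverges {N : ℕ} (Ωs : ℕ → Set (EuclideanSpace ℝ (Fin N)))
    (Ω : Set (EuclideanSpace ℝ (Fin N))) : Prop :=
  ∀ ε : ℝ, 0 < ε → ∀ᶠ n in atTop,
    Ωs n ⊆ Ω + Metric.ball 0 ε ∧ Ω ⊆ Ωs n + Metric.ball 0 ε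

/-- Smooth real functions with compact support contained in `Ω`. -/
structure IsTestFunction {N : ℕ} (Ω : Set (EuclideanSpace ℝ (Fin N)))
    (φ : EuclideanSpace ℝ (Fin N) → ℝ) : Prop where
  smooth : ContDiff ℝ ∞ φ
  compact : HasCompactSupport φ
  support_subset : tsupport φ ⊆ Ω

/-- The Hilbert space `L²(Ω) × L²(Ω; ℝᴺ)`. A Sobolev function `u` is represented in it by the
pair `(u, ∇u)`, and the norm of the pair is then the `H¹` norm of `u`. -/
abbrev SobolevPair {N : ℕ} (Ω : Set (EuclideanSpace ℝ (Fin N))) : Type :=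
  WithLp 2 (Lp ℝ 2 (volume.restrict Ω) × Lp (EuclideanSpace ℝ (Fin N)) 2 (volume.restrict Ω))

/-- The pairs `(φ, ∇φ)`, where `φ` is a test function in `Ω`. -/
def testPairs {N : ℕ} (Ω : Set (EuclideanSpace ℝ (Fin N))) : Submodule ℝ (SobolevPair Ω) where
  carrier := {w | ∃ φ : EuclideanSpace ℝ (Fin N) → ℝ, IsTestFunction Ω φ ∧
    w.fst =ᵐ[volume.restrict Ω] φ ∧ w.snd =ᵐ[volume.restrict Ω] fun x => ∇ φ x}
  add_mem' := by
    rintro a b ⟨φ, hφ, ha1, ha2⟩ ⟨ψ, hψ, hb1, hb2⟩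
    refine ⟨φ + ψ, ⟨hφ.smooth.add hψ.smooth, hφ.compact.add hψ.compact,
      (tsupport_add φ ψ).trans (Set.union_subset hφ.support_subset hψ.support_subset)⟩, ?_, ?_⟩
    · filter_upwards [ha1, hb1, Lp.coeFn_add a.fst b.fst] with x h1 h2 h3
      rw [WithLp.add_fst, h3, Pi.add_apply, Pi.add_apply, h1, h2]
    · filter_upwards [ha2, hb2, Lp.coeFn_add a.snd b.snd] with x h1 h2 h3
      rw [WithLp.add_snd, h3, Pi.add_apply, h1, h2]
      simp only [gradient]
      rw [fderiv_add (hφ.smooth.differentiable (by simp) x)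
        (hψ.smooth.differentiable (by simp) x), map_add]
  zero_mem' := by
    refine ⟨0, ⟨contDiff_const, HasCompactSupport.zero, by simp [tsupport]⟩, ?_, ?_⟩
    · exact Lp.coeFn_zero _ _ _
    · filter_upwards [Lp.coeFn_zero (EuclideanSpace ℝ (Fin N)) 2 (volume.restrict Ω)] with x h1
      rw [WithLp.zero_snd, h1]
      simp [gradient]
  smul_mem' := by
    rintro c a ⟨φ, hφ, ha1, ha2⟩
    refine ⟨c • φ, ⟨hφ.smooth.const_smul c, hφ.compact.smul_left (f := fun _ => c),
      (closure_mono (Function.support_const_smul_subset c φ)).trans hφ.support_subset⟩, ?_, ?_⟩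
    · filter_upwards [ha1, Lp.coeFn_smul c a.fst] with x h1 h2
      rw [WithLp.smul_fst, h2, Pi.smul_apply, Pi.smul_apply, h1]
    · filter_upwards [ha2, Lp.coeFn_smul c a.snd] with x h1 h2
      rw [WithLp.smul_snd, h2, Pi.smul_apply, h1]
      simp only [gradient]
      rw [fderiv_const_smul (hφ.smooth.differentiable (by simp) x), map_smul]

/-- The Sobolev space `H¹₀(Ω)`: the closure of the test functions in the `H¹` norm. For an
element `w`, `w.fst` is the function and `w.snd` is its weak gradient. -/
def H10 {N : ℕ} (Ω : Set (EuclideanSpace ℝ (Fin N))) : Submodule ℝ (SobolevPair Ω) :=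
  (testPairs Ω).topologicalClosure

/-- `u ∈ H¹₀(Ω)` solves `-∂ᵢ(aᵢⱼ ∂ⱼ u) = s u` weakly in `Ω`, with zero Dirichlet condition. -/
def IsWeakEigenSolution {N : ℕ} (A : Matrix (Fin N) (Fin N) ℝ)
    (Ω : Set (EuclideanSpace ℝ (Fin N))) (s : ℝ) (u : H10 Ω) : Prop :=
  ∀ v : H10 Ω,
    ∫ x in Ω, ∑ i, ∑ j, A i j * u.1.snd x j * v.1.snd x i =
      s * ∫ x in Ω, u.1.fst x * v.1.fst x

/-- The real numbers `t` such that at least `k` Dirichlet eigenvalues, counted with multiplicity,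
are at most `t`: there are `k` linearly independent eigenfunctions with eigenvalues `≤ t`. -/
def eigenvalueLevels {N : ℕ} (A : Matrix (Fin N) (Fin N) ℝ) (k : ℕ)
    (Ω : Set (EuclideanSpace ℝ (Fin N))) : Set ℝ :=
  {t | ∃ u : Fin k → H10 Ω, LinearIndependent ℝ u ∧
    ∀ i, ∃ s : ℝ, s ≤ t ∧ IsWeakEigenSolution A Ω s (u i)}

/-- The `k`-th Dirichlet eigenvalue (`k ≥ 1`) of `-∂ᵢ(aᵢⱼ ∂ⱼ u)` on `Ω`, the eigenvalues being
listed in increasing order and repeated according to multiplicity. -/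
def dirichletEigenvalue {N : ℕ} (A : Matrix (Fin N) (Fin N) ℝ) (k : ℕ)
    (Ω : Set (EuclideanSpace ℝ (Fin N))) : EReal :=
  sInf ((fun t : ℝ => (t : EReal)) '' eigenvalueLevels A k Ω)

end

/-! Dirichlet eigenvalues decrease when the domain grows, and since the coefficients are constant
they are translation invariant and scale by the inverse square of the dilation factor. Convexity
turns Hausdorff closeness into inclusion up to a dilation: if `Q` is convex, contains a ball of
radius `ρ` about `x`, and `P ⊆ Q + B(ε)`, then shrinking `P` about `x` by the factor `1 + ε / ρ`
puts it inside `Q`. Hence `λ_k(Q) ≤ (1 + ε / ρ)² λ_k(P)` (`level_le_of_subset_add_ball`). Applied in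
both directions, with a `ρ` common to the whole class, this squeezes `λ_k(Ω_n)` to `λ_k(Ω)`.

The common `ρ` comes from `exists_uniform_inradius`: a simplex of maximal volume in the closure of
`Ω` has volume bounded below in terms of `m`, while its edges are bounded in terms of `D`.
Boundedness of `λ_k` follows by comparison with the ball of radius `ρ`.

Monotonicity needs a variational description of eigenvalues defined by weak solutions. With the norm
`energy + L²` on `H¹₀(Ω)`, the embedding `J` into `L²(Ω)` is compact (Rellich), and `λ` is an
eigenvalue exactly when `(λ + 1)⁻¹` is an eigenvalue of `J* J`. The singular value decomposition of
`J` gives existence and min-max. By density, the min-max value can be computed on spaces of test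
functions (`exists_isLeast_eigenvalueLevels`); these live on the whole of `ℝᴺ`, so different domains
can be compared directly. -/

/-! ### Singular values of compact operators between Hilbert spaces. -/

section Spectral

variable {E F : Type*} [NormedAddCommGroup E] [InnerProductSpace ℝ E] [CompleteSpace E]
  [NormedAddCommGroup F] [InnerProductSpace ℝ F] [CompleteSpace F]

open scoped InnerProductSpace

/-- A nonzero compact operator attains its norm, at a singular vector. -/
theorem IsCompactOperator.exists_top_singular_vector (J : E →L[ℝ] F) (hJ : IsCompactOperator J)
    (h0 : J ≠ 0) :
    ∃ e : E, ‖e‖ = 1 ∧ ∀ v, ⟪J e, J v⟫_ℝ = ‖J‖ ^ 2 * ⟪e, v⟫_ℝ := by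
  have hpos : 0 < ‖J‖ := norm_pos_iff.mpr h0
  set T : E →L[ℝ] E := (ContinuousLinearMap.adjoint J).comp J with hT
  have hTin : ∀ u v, ⟪T u, v⟫_ℝ = ⟪J u, J v⟫_ℝ := fun u v => by
    simp [hT, ContinuousLinearMap.adjoint_inner_left]
  have hTc : IsCompactOperator T := hJ.clm_comp (ContinuousLinearMap.adjoint J)
  -- Expanding the square bounds the defect of `u` as an eigenvector of `T = J* J` by how far `‖J
  -- u‖` is from the maximum, so a maximizing sequence consists of approximate eigenvectors.
  have key : ∀ u, ‖u‖ ≤ 1 → ‖T u - ‖J‖ ^ 2 • u‖ ^ 2 ≤ ‖J‖ ^ 2 * (‖J‖ ^ 2 - ‖J u‖ ^ 2) := by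
    intro u hu
    have h1 : ‖T u‖ ≤ ‖J‖ * ‖J u‖ := by
      have := (ContinuousLinearMap.adjoint J).le_opNorm (J u)
      rwa [LinearIsometryEquiv.norm_map] at this
    have h2 : ‖T u‖ ^ 2 ≤ ‖J‖ ^ 2 * ‖J u‖ ^ 2 := by
      rw [← mul_pow]; exact pow_le_pow_left₀ (norm_nonneg _) h1 2
    have h3 : ‖u‖ ^ 2 ≤ 1 := pow_le_one₀ (norm_nonneg _) hu
    rw [@norm_sub_sq ℝ, inner_smul_right, hTin, real_inner_self_eq_norm_sq, norm_smul]
    simp only [RCLike.re_to_real, Real.norm_eq_abs, mul_pow, sq_abs]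
    nlinarith [sq_nonneg (‖J‖ ^ 2), mul_le_mul_of_nonneg_left h3 (sq_nonneg (‖J‖ ^ 2))]
  have hex : ∀ n : ℕ, ∃ u : E, ‖u‖ < 1 ∧ ‖J‖ - 1 / ((n : ℝ) + 1) < ‖J u‖ := fun n =>
    J.exists_lt_apply_of_lt_opNorm (by
      have : (0 : ℝ) < 1 / ((n : ℝ) + 1) := by positivity
      linarith)
  choose u hu1 hu2 using hex
  have hJu : Tendsto (fun n => ‖J (u n)‖) atTop (𝓝 ‖J‖) := by
    refine tendsto_of_tendsto_of_tendsto_of_le_of_le (g := fun n : ℕ => ‖J‖ - 1 / ((n : ℝ) + 1))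
      (h := fun _ => ‖J‖) ?_ tendsto_const_nhds (fun n => (hu2 n).le) (fun n => ?_)
    · simpa using (tendsto_const_nhds (x := ‖J‖)).sub
        (tendsto_one_div_add_atTop_nhds_zero_nat (𝕜 := ℝ))
    · exact (J.le_opNorm _).trans (mul_le_of_le_one_right (norm_nonneg _) (hu1 n).le)
  have hcomp := hTc.isCompact_closure_image_closedBall (r := 1)
  obtain ⟨y, -, ψ, hψ, hy⟩ := hcomp.tendsto_subseq (x := fun n => T (u n)) (fun n =>
    subset_closure (Set.mem_image_of_mem _ (by simpa using (hu1 n).le)))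
  have hdiff : Tendsto (fun n => T (u n) - ‖J‖ ^ 2 • u n) atTop (𝓝 0) := by
    rw [tendsto_zero_iff_norm_tendsto_zero]
    have h : Tendsto (fun n => ‖T (u n) - ‖J‖ ^ 2 • u n‖ ^ 2) atTop (𝓝 0) := by
      refine squeeze_zero (fun n => by positivity) (fun n => key (u n) (hu1 n).le) ?_
      have := ((tendsto_const_nhds (x := ‖J‖ ^ 2)).sub (hJu.pow 2)).const_mul (‖J‖ ^ 2)
      simpa using this
    simpa using h.sqrt
  -- Compactness makes `T u` converge along a subsequence; as `T u - ‖J‖² u` tends to zero and `‖J‖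
  -- ≠ 0`, the vectors `u` themselves converge in norm.
  have hlim : Tendsto (fun n => u (ψ n)) atTop (𝓝 ((‖J‖ ^ 2)⁻¹ • y)) := by
    have := (hy.sub (hdiff.comp hψ.tendsto_atTop)).const_smul ((‖J‖ ^ 2)⁻¹)
    simpa [smul_smul, inv_mul_cancel₀ (pow_pos hpos 2).ne'] using this
  set e := (‖J‖ ^ 2)⁻¹ • y
  have he1 : ‖e‖ ≤ 1 := le_of_tendsto hlim.norm (Eventually.of_forall fun n => (hu1 _).le)
  have hJe : ‖J e‖ = ‖J‖ :=
    tendsto_nhds_unique ((J.continuous.tendsto e).comp hlim).norm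
      (hJu.comp hψ.tendsto_atTop)
  refine ⟨e, le_antisymm he1 ?_, fun v => ?_⟩
  · have := J.le_opNorm e
    rw [hJe] at this
    exact le_of_mul_le_mul_left (by simpa using this) hpos
  · have h := key e he1
    rw [hJe, sub_self, mul_zero] at h
    have h' : T e - ‖J‖ ^ 2 • e = 0 := by
      rw [← norm_eq_zero]; exact pow_eq_zero_iff (two_ne_zero) |>.mp (le_antisymm h (sq_nonneg _))
    rw [← hTin, sub_eq_zero.mp h', inner_smul_left]; rfl

/-- The first `k` singular vectors of a compact operator of infinite rank. -/
theorem IsCompactOperator.exists_singular_system (J : E →L[ℝ] F) (hJ : IsCompactOperator J)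
    (hrank : ∀ k, ∃ w : Fin k → E, LinearIndependent ℝ (fun i => J (w i))) (k : ℕ) :
    ∃ (e : Fin k → E) (μ : Fin k → ℝ), Orthonormal ℝ e ∧ (∀ i, 0 < μ i) ∧
      (∀ i v, ⟪J (e i), J v⟫_ℝ = μ i * ⟪e i, v⟫_ℝ) ∧
      ∀ i v, (∀ j < i, ⟪e j, v⟫_ℝ = 0) → ‖J v‖ ^ 2 ≤ μ i * ‖v‖ ^ 2 := by
  induction k with
  | zero => exact ⟨Fin.elim0, Fin.elim0, ⟨fun i => i.elim0, fun i => i.elim0⟩, fun i => i.elim0,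
      fun i => i.elim0, fun i => i.elim0⟩
  | succ k ih =>
    obtain ⟨e, μ, ho, hμ, he, hmax⟩ := ih
    set W : Submodule ℝ E := (Submodule.span ℝ (Set.range e))ᗮ with hW
    have memW : ∀ v, v ∈ W ↔ ∀ i, ⟪e i, v⟫_ℝ = 0 := by
      intro v
      rw [hW, Submodule.mem_orthogonal]
      refine ⟨fun h i => h _ (Submodule.subset_span ⟨i, rfl⟩), fun h u hu => ?_⟩
      induction hu using Submodule.span_induction with
      | mem x hx => obtain ⟨i, rfl⟩ := hx; exact h i
      | zero => simp
      | add x y _ _ hx hy => rw [inner_add_left, hx, hy, add_zero]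
      | smul c x _ hx => rw [inner_smul_left, hx, mul_zero]
    set JW : W →L[ℝ] F := J.comp W.subtypeL with hJW
    have hJWc : IsCompactOperator JW := hJ.comp_clm W.subtypeL
    -- Among `k + 1` vectors with independent images, the `k` conditions of orthogonality to `e`
    -- leave a nontrivial combination in `W`, and its image is nonzero.
    have hne : JW ≠ 0 := by
      intro h0
      obtain ⟨w, hw⟩ := hrank (k + 1)
      let f : (Fin (k + 1) → ℝ) →ₗ[ℝ] (Fin k → ℝ) := LinearMap.pi fun i =>
        (innerSL ℝ (e i)).toLinearMap ∘ₗ Fintype.linearCombination ℝ w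
      have hker : LinearMap.ker f ≠ ⊥ := LinearMap.ker_ne_bot_of_finrank_lt (by simp)
      obtain ⟨c, hc, hc0⟩ := (Submodule.ne_bot_iff _).mp hker
      have hmem : ∑ i, c i • w i ∈ W := by
        rw [memW]; intro i
        have := congrFun (LinearMap.mem_ker.mp hc) i
        simpa [f, Fintype.linearCombination_apply] using this
      have hz : J (∑ i, c i • w i) = 0 := by
        simpa [hJW] using congrArg (fun g => g ⟨_, hmem⟩) h0
      rw [map_sum] at hz
      simp only [map_smul] at hz
      exact hc0 (funext (Fintype.linearIndependent_iff.mp hw c hz))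
    obtain ⟨f, hf1, hf2⟩ := hJWc.exists_top_singular_vector JW hne
    have hfW : ∀ i, ⟪e i, (f : E)⟫_ℝ = 0 := (memW f).mp f.2
    have hfW' : ∀ i, ⟪(f : E), e i⟫_ℝ = 0 := fun i => by rw [real_inner_comm]; exact hfW i
    have hν : 0 < ‖JW‖ ^ 2 := by
      have : ‖JW‖ ≠ 0 := fun h => hne (JW.opNorm_zero_iff.mp h)
      positivity
    have hfn : ‖(f : E)‖ = 1 := hf1
    -- The identity on `W` extends to all of `E`, because on the span of `e` both sides vanish by
    -- the singular identity for each `e i`.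
    have hfe : ∀ v, ⟪J f, J v⟫_ℝ = ‖JW‖ ^ 2 * ⟪(f : E), v⟫_ℝ := by
      intro v
      have : FiniteDimensional ℝ (Submodule.span ℝ (Set.range e)) :=
        FiniteDimensional.span_of_finite ℝ (Set.finite_range e)
      have hspan : ∀ u ∈ Submodule.span ℝ (Set.range e),
          ⟪J f, J u⟫_ℝ = 0 ∧ ⟪(f : E), u⟫_ℝ = 0 := by
        intro u hu
        induction hu using Submodule.span_induction with
        | mem x hx =>
          obtain ⟨i, rfl⟩ := hx
          exact ⟨by rw [real_inner_comm, he, hfW, mul_zero], hfW' i⟩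
        | zero => simp
        | add x y _ _ hx hy => simp [inner_add_right, hx, hy]
        | smul c x _ hx => simp [inner_smul_right, hx]
      obtain ⟨a, ha, b, hb, rfl⟩ :=
        (Submodule.span ℝ (Set.range e)).exists_add_mem_mem_orthogonal v
      have := hf2 ⟨b, hb⟩
      simp only [hJW, ContinuousLinearMap.comp_apply, Submodule.subtypeL_apply,
        Submodule.coe_inner] at this
      rw [map_add, inner_add_right, inner_add_right, (hspan a ha).1, (hspan a ha).2, this]
      ring
    refine ⟨Fin.snoc (α := fun _ => E) e f, Fin.snoc (α := fun _ => ℝ) μ (‖JW‖ ^ 2),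
      ⟨?_, ?_⟩, ?_, ?_, ?_⟩
    · intro i
      refine Fin.lastCases ?_ (fun i => ?_) i
      · simpa using hf1
      · simpa using ho.1 i
    · intro i j
      refine Fin.lastCases ?_ (fun i => ?_) i <;> refine Fin.lastCases ?_ (fun j => ?_) j
      · intro h; exact absurd rfl h
      · intro _; simpa using hfW' j
      · intro _; simpa using hfW i
      · intro h; simpa using ho.2 (fun h' => h (by rw [h']))
    · intro i
      refine Fin.lastCases ?_ (fun i => ?_) i
      · simpa using hν
      · simpa using hμ i
    · intro i
      refine Fin.lastCases ?_ (fun i => ?_) i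
      · simpa using hfe
      · simpa using he i
    · intro i
      refine Fin.lastCases ?_ (fun i => ?_) i
      · intro v hv
        have hvW : v ∈ W := (memW v).mpr fun i => by
          simpa using hv i.castSucc (Fin.castSucc_lt_last i)
        have := JW.le_opNorm ⟨v, hvW⟩
        have h2 := pow_le_pow_left₀ (norm_nonneg _) this 2
        rw [mul_pow] at h2
        simpa [hJW] using h2
      · intro v hv
        have := hmax i v fun j hj => by
          simpa using hv j.castSucc (by simpa using hj)
        simpa using this

/-- Min-max description of the singular values of a compact operator of infinite rank. -/
theorem IsCompactOperator.exists_singular_minmax (J : E →L[ℝ] F) (hJ : IsCompactOperator J)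
    (hrank : ∀ k, ∃ w : Fin k → E, LinearIndependent ℝ (fun i => J (w i))) (n : ℕ) :
    ∃ (e : Fin (n + 1) → E) (μ : Fin (n + 1) → ℝ), Orthonormal ℝ e ∧ 0 < μ (Fin.last n) ∧
      (∀ i, μ (Fin.last n) ≤ μ i) ∧ (∀ i v, ⟪J (e i), J v⟫_ℝ = μ i * ⟪e i, v⟫_ℝ) ∧
      ∀ w : Fin (n + 1) → E, ∃ c : Fin (n + 1) → ℝ, c ≠ 0 ∧
        ‖J (∑ i, c i • w i)‖ ^ 2 ≤ μ (Fin.last n) * ‖∑ i, c i • w i‖ ^ 2 := by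
  obtain ⟨e, μ, ho, hμ, he, hmax⟩ := hJ.exists_singular_system J hrank (n + 1)
  refine ⟨e, μ, ho, hμ _, fun i => ?_, he, fun w => ?_⟩
  · rcases (Fin.le_last i).lt_or_eq with hi | hi
    · have h1 := hmax i (e (Fin.last n)) fun j hj => ho.2 (hj.trans hi).ne
      have h2 := he (Fin.last n) (e (Fin.last n))
      simpa [real_inner_self_eq_norm_sq, ho.1, h2.symm] using h2.symm.le.trans
        ((real_inner_self_eq_norm_sq _).le.trans h1)
    · rw [hi]
  · let f : (Fin (n + 1) → ℝ) →ₗ[ℝ] (Fin n → ℝ) := LinearMap.pi fun i =>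
      (innerSL ℝ (e i.castSucc)).toLinearMap ∘ₗ Fintype.linearCombination ℝ w
    have hker : LinearMap.ker f ≠ ⊥ := LinearMap.ker_ne_bot_of_finrank_lt (by simp)
    obtain ⟨c, hc, hc0⟩ := (Submodule.ne_bot_iff _).mp hker
    refine ⟨c, hc0, hmax _ _ fun j hj => ?_⟩
    have := congrFun (LinearMap.mem_ker.mp hc) (j.castPred hj.ne)
    simpa [f, Fintype.linearCombination_apply] using this

end Spectral

/-! ### Homotheties and inradius of convex sets. -/

section ConvexGeometry

variable {N : ℕ}

/-- If `Q` is convex and contains a ball of radius `ρ` about `x`, the homothety of centre `x` and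
ratio `(1 + ε / ρ)⁻¹` maps the `ε`-enlargement of `Q` into `Q`. -/
theorem Convex.homothety_mem_of_subset_add_ball {E : Type*} [NormedAddCommGroup E]
    [NormedSpace ℝ E] {P Q : Set E} (hQ : Convex ℝ Q) {x : E} {ρ ε : ℝ} (hρ : 0 < ρ)
    (hε : 0 < ε) (hball : Metric.ball x ρ ⊆ Q) (hPQ : P ⊆ Q + Metric.ball 0 ε) {y : E}
    (hy : y ∈ P) : x + (1 + ε / ρ)⁻¹ • (y - x) ∈ Q := by
  obtain ⟨q, hq, z, hz, rfl⟩ := Set.mem_add.mp (hPQ hy)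
  have hz' : ‖z‖ < ε := by simpa using hz
  -- The image of `q + z` is the convex combination of `q` and `x + (ρ / ε) z` with weights `ρ / (ρ
  -- + ε)` and `ε / (ρ + ε)`; the second point lies in the given ball.
  have hmem : x + (ρ / ε) • z ∈ Q := by
    apply hball
    rw [Metric.mem_ball, dist_self_add_left, norm_smul, Real.norm_of_nonneg (by positivity)]
    calc ρ / ε * ‖z‖ < ρ / ε * ε := by gcongr
      _ = ρ := by field_simp
  have hθ : (1 + ε / ρ)⁻¹ = ρ / (ρ + ε) := by field_simp
  have := hQ hq hmem (a := ρ / (ρ + ε)) (b := ε / (ρ + ε)) (by positivity) (by positivity)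
    (by field_simp)
  rw [hθ]
  convert this using 1
  have h1 : x = (ρ / (ρ + ε)) • x + (ε / (ρ + ε)) • x := by
    rw [← add_smul, ← add_div, div_self (by positivity), one_smul]
  have h2 : ε / (ρ + ε) * (ρ / ε) = ρ / (ρ + ε) := by field_simp
  nth_rewrite 1 [h1]
  rw [smul_add (ε / (ρ + ε)), smul_smul, h2]
  module

/-- The square matrix whose columns are the edge vectors of a simplex issued from vertex `0`. -/
def edgeMatrix (p : Fin (N + 1) → EuclideanSpace ℝ (Fin N)) : Matrix (Fin N) (Fin N) ℝ :=
  Matrix.of fun i j => p j.succ i - p 0 i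

theorem continuous_abs_det_edgeMatrix :
    Continuous fun p : Fin (N + 1) → EuclideanSpace ℝ (Fin N) => |(edgeMatrix p).det| := by
  refine (Continuous.matrix_det ?_).abs
  refine continuous_matrix fun i j => ?_
  simp only [edgeMatrix, Matrix.of_apply]
  fun_prop

/-- Cramer's rule, kept free of division: the coordinates of `z` along the edges are the Cramer
numerators over the determinant. -/
theorem det_smul_eq_sum_cramer (p : Fin (N + 1) → EuclideanSpace ℝ (Fin N))
    (z : EuclideanSpace ℝ (Fin N)) :
    (edgeMatrix p).det • z = ∑ j, (edgeMatrix p).cramer z j • (p j.succ - p 0) := by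
  ext i
  have := congrFun ((edgeMatrix p).mulVec_cramer z) i
  simp only [Matrix.mulVec, dotProduct, Pi.smul_apply, smul_eq_mul] at this
  simp only [PiLp.smul_apply, smul_eq_mul, WithLp.ofLp_sum, Finset.sum_apply, PiLp.sub_apply,
    ← this]
  refine Finset.sum_congr rfl fun j _ => ?_
  simp [edgeMatrix, mul_comm]

/-- Moving one vertex to `x` turns the determinant into a Cramer numerator of `x - p 0`. For a
simplex of maximal volume, every point of the set therefore has edge coordinates in `[-1, 1]`. -/
theorem edgeMatrix_update_succ (p : Fin (N + 1) → EuclideanSpace ℝ (Fin N)) (j : Fin N)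
    (x : EuclideanSpace ℝ (Fin N)) :
    (edgeMatrix (Function.update p j.succ x)).det = (edgeMatrix p).cramer (x - p 0).ofLp j := by
  rw [Matrix.cramer_apply]
  congr 1
  ext a b
  by_cases h : b = j
  · subst h
    simp [edgeMatrix, Function.update_of_ne (Fin.succ_ne_zero _).symm]
  · simp [edgeMatrix, Function.update_of_ne (Fin.succ_ne_zero _).symm, h]

theorem exists_edgeMatrix_det_ne_zero {Ω : Set (EuclideanSpace ℝ (Fin N))} (ho : IsOpen Ω)
    (hne : Ω.Nonempty) :
    ∃ p : Fin (N + 1) → EuclideanSpace ℝ (Fin N), (∀ i, p i ∈ Ω) ∧ (edgeMatrix p).det ≠ 0 := by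
  obtain ⟨y, hy⟩ := hne
  obtain ⟨r, hr, hball⟩ := Metric.isOpen_iff.mp ho y hy
  refine ⟨Fin.cons y fun i => y + EuclideanSpace.single i (r / 2), ?_, ?_⟩
  · intro i
    refine Fin.cases ?_ (fun i => ?_) i
    · simpa using hy
    · apply hball
      simp [abs_of_pos hr, hr]
  · have : edgeMatrix (Fin.cons y fun i => y + EuclideanSpace.single i (r / 2)) =
        Matrix.diagonal fun _ : Fin N => r / 2 := by
      ext a b
      by_cases h : a = b
      · subst h; simp [edgeMatrix]
      · simp [edgeMatrix, h]
    rw [this, Matrix.det_diagonal]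
    simp [hr.ne']

theorem Convex.add_sum_smul_mem {E : Type*} [AddCommGroup E] [Module ℝ E] {K : Set E}
    (hK : Convex ℝ K) {p : Fin (N + 1) → E} (hp : ∀ i, p i ∈ K) {c : Fin N → ℝ}
    (hc : ∀ i, 0 ≤ c i) (hc1 : ∑ i, c i ≤ 1) : p 0 + ∑ i, c i • (p i.succ - p 0) ∈ K := by
  have := hK.sum_mem (t := Finset.univ)
    (w := (Fin.cons (1 - ∑ i, c i) c : Fin (N + 1) → ℝ)) (z := p)
    (fun i _ => by
      refine Fin.cases ?_ (fun i => ?_) i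
      · simpa using hc1
      · simpa using hc i)
    (by simp [Fin.sum_univ_succ]) (fun i _ => hp i)
  rw [Fin.sum_univ_succ] at this
  convert this using 1
  simp only [Fin.cons_zero, Fin.cons_succ, smul_sub, Finset.sum_sub_distrib, sub_smul, one_smul,
    Finset.sum_smul]
  abel

/-- By homogeneity `z` may be scaled into the unit ball; then all entries of the matrix with
replaced column are at most `C`, the new ones because `1 ≤ C`, and the Leibniz expansion has `N!`
terms. -/
theorem abs_cramer_edgeMatrix_le {p : Fin (N + 1) → EuclideanSpace ℝ (Fin N)} {C : ℝ}
    (hC : 1 ≤ C) (hp : ∀ i j, |edgeMatrix p i j| ≤ C) {ρ : ℝ} (hρ : 0 < ρ)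
    {z : EuclideanSpace ℝ (Fin N)} (hz : ‖z‖ ≤ ρ) (j : Fin N) :
    |(edgeMatrix p).cramer z j| ≤ ρ * (N.factorial * C ^ N) := by
  have h1 : (z : Fin N → ℝ) = ρ • ((ρ⁻¹ • z : EuclideanSpace ℝ (Fin N)) : Fin N → ℝ) := by
    ext i; simp [mul_inv_cancel_left₀ hρ.ne']
  rw [h1, map_smul, Pi.smul_apply, smul_eq_mul, abs_mul, abs_of_pos hρ]
  refine mul_le_mul_of_nonneg_left ?_ hρ.le
  rw [Matrix.cramer_apply]
  have := Matrix.det_le (A := (edgeMatrix p).updateCol j (ρ⁻¹ • z : EuclideanSpace ℝ (Fin N)))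
    (abv := AbsoluteValue.abs) (x := C) (fun a b => ?_)
  · simpa using this
  · by_cases h : b = j
    · subst h
      simp only [Matrix.updateCol_self, AbsoluteValue.abs_apply]
      refine le_trans ?_ hC
      have h2 := (PiLp.norm_apply_le (ρ⁻¹ • z) a)
      rw [Real.norm_eq_abs] at h2
      refine h2.trans ?_
      rw [norm_smul, norm_inv, Real.norm_of_nonneg hρ.le]
      exact inv_mul_le_one_of_le₀ hz hρ.le
    · simpa [h] using hp a b

/-- A convex set containing the vertices of a simplex contains a ball of radius controlled from
below by the determinant of the edges. -/
theorem Convex.ball_subset_of_edgeMatrix (hN : 1 ≤ N) {K : Set (EuclideanSpace ℝ (Fin N))}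
    (hK : Convex ℝ K) {p : Fin (N + 1) → EuclideanSpace ℝ (Fin N)} (hp : ∀ i, p i ∈ K) {C : ℝ}
    (hC : 1 ≤ C) (hpC : ∀ i j, |edgeMatrix p i j| ≤ C) {ρ : ℝ} (hρ : 0 < ρ)
    (hd : ρ * (N.factorial * C ^ N) * (2 * N) ≤ |(edgeMatrix p).det|) :
    ∃ q, Metric.ball q ρ ⊆ K := by
  have hNpos : (0 : ℝ) < N := by exact_mod_cast hN
  have hd0 : 0 < |(edgeMatrix p).det| := lt_of_lt_of_le (by positivity) hd
  have hd0' : (edgeMatrix p).det ≠ 0 := abs_pos.mp hd0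
  -- The centre has all edge coordinates `1 / (2N)`. A perturbation of each by at most `1 / (2N)`
  -- keeps them in `[0, 1 / N]`, hence inside the simplex.
  refine ⟨p 0 + ∑ j : Fin N, (1 / (2 * N) : ℝ) • (p j.succ - p 0), fun y hy => ?_⟩
  set q := p 0 + ∑ j : Fin N, (1 / (2 * N) : ℝ) • (p j.succ - p 0) with hq
  obtain ⟨z, rfl⟩ : ∃ z, y = q + z := ⟨y - q, by abel⟩
  have hz : ‖z‖ ≤ ρ := by simpa using (Metric.mem_ball.mp hy).le
  set b : Fin N → ℝ := fun j => (edgeMatrix p).cramer z j / (edgeMatrix p).det with hbdef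
  have hb : ∀ j, |b j| ≤ 1 / (2 * N) := by
    intro j
    have h1 := abs_cramer_edgeMatrix_le hC hpC hρ hz j
    rw [hbdef]
    simp only [abs_div]
    rw [div_le_div_iff₀ hd0 (by positivity), one_mul]
    exact (mul_le_mul_of_nonneg_right h1 (by positivity)).trans hd
  have hz' : z = ∑ j, b j • (p j.succ - p 0) := by
    have h1 := det_smul_eq_sum_cramer p z
    rw [← inv_smul_smul₀ hd0' z, h1, Finset.smul_sum]
    simp only [hbdef, smul_smul, div_eq_inv_mul]
  have hy' : q + z = p 0 + ∑ j, (1 / (2 * N) + b j) • (p j.succ - p 0) := by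
    rw [hq, hz']
    simp only [add_smul, Finset.sum_add_distrib, add_assoc]
  rw [hy']
  refine hK.add_sum_smul_mem hp (fun j => ?_) ?_
  · have := (abs_le.mp (hb j)).1; linarith
  · calc _ ≤ ∑ _j : Fin N, (1 / N : ℝ) := by
          refine Finset.sum_le_sum fun j _ => ?_
          have := (abs_le.mp (hb j)).2
          have h2 : (1 / N : ℝ) = 1 / (2 * N) + 1 / (2 * N) := by field_simp; norm_num
          linarith
      _ = 1 := by simp [hNpos.ne']

/-- If all points of `Ω` have bounded coordinates with respect to the edges of a simplex, the
volume of `Ω` is controlled by the determinant of the edges. -/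
theorem volume_le_abs_det_edgeMatrix (hN : 1 ≤ N) {Ω : Set (EuclideanSpace ℝ (Fin N))}
    {p : Fin (N + 1) → EuclideanSpace ℝ (Fin N)} (hd : (edgeMatrix p).det ≠ 0)
    (h : ∀ x ∈ Ω, ∀ j, |(edgeMatrix p).cramer (x - p 0).ofLp j| ≤ |(edgeMatrix p).det|) :
    volume Ω ≤ ENNReal.ofReal |(edgeMatrix p).det| *
      volume (Metric.closedBall (0 : EuclideanSpace ℝ (Fin N)) N) := by
  have hd0 : 0 < |(edgeMatrix p).det| := abs_pos.mpr hd
  set T := Matrix.toEuclideanLin (edgeMatrix p)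
  -- Coordinates in `[-1, 1]` give Euclidean norm at most `√N ≤ N`.
  have hsub : Ω ⊆ (fun z => p 0 + z) '' (T '' Metric.closedBall 0 N) := by
    intro x hx
    refine ⟨x - p 0, ⟨WithLp.toLp 2 fun j =>
      (edgeMatrix p).cramer (x - p 0).ofLp j / (edgeMatrix p).det, ?_, ?_⟩, by simp⟩
    · rw [mem_closedBall_zero_iff, EuclideanSpace.norm_eq]
      refine Real.sqrt_le_iff.mpr ⟨by positivity, ?_⟩
      calc _ ≤ ∑ _j : Fin N, (1 : ℝ) := by
            refine Finset.sum_le_sum fun j _ => ?_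
            refine pow_le_one₀ (norm_nonneg _) ?_
            rw [Real.norm_eq_abs, abs_div]
            exact div_le_one_of_le₀ (h x hx j) hd0.le
        _ = N := by simp
        _ ≤ (N : ℝ) ^ 2 := by
            have : (1 : ℝ) ≤ N := by exact_mod_cast hN
            nlinarith
    · have h3 := (edgeMatrix p).mulVec_cramer (x - p 0).ofLp
      have h5 : (fun j => (edgeMatrix p).cramer (x - p 0).ofLp j / (edgeMatrix p).det) =
          (edgeMatrix p).det⁻¹ • (edgeMatrix p).cramer (x - p 0).ofLp := by
        ext j; simp [div_eq_inv_mul]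
      simp only [T, Matrix.toLpLin_apply]
      rw [h5, Matrix.mulVec_smul, h3, smul_smul, inv_mul_cancel₀ hd, one_smul]
  have hdet : LinearMap.det T = (edgeMatrix p).det := by
    simp only [T, Matrix.toEuclideanLin_eq_toLin_orthonormal]
    rw [LinearMap.det_toLin]
  have h1 := measure_mono (μ := volume) hsub
  rwa [Set.image_add_left, measure_preimage_add, Measure.addHaar_image_linearMap, hdet] at h1

/-- The convex sets of volume `m` in a compact set contain balls of a common radius. -/
theorem exists_uniform_inradius (hN : 1 ≤ N) {D : Set (EuclideanSpace ℝ (Fin N))}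
    (hD : IsCompact D) {m : ℝ} (hm : 0 < m) :
    ∃ ρ > 0, ∀ Ω ∈ convexClass D m, ∃ x, Metric.ball x ρ ⊆ Ω := by
  obtain ⟨R, hR⟩ := hD.isBounded.exists_norm_le
  obtain ⟨C, hC, hRC⟩ : ∃ C : ℝ, 1 ≤ C ∧ 2 * R ≤ C := ⟨_, le_max_left _ _, le_max_right _ _⟩
  have hNpos : (0 : ℝ) < N := by exact_mod_cast hN
  set V := volume (Metric.closedBall (0 : EuclideanSpace ℝ (Fin N)) N)
  have hVfin : V ≠ ⊤ := measure_closedBall_lt_top.ne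
  have hVpos : 0 < V.toReal :=
    ENNReal.toReal_pos (Metric.measure_closedBall_pos _ _ hNpos).ne' hVfin
  -- This radius makes the requirement of `Convex.ball_subset_of_edgeMatrix` read `m / V ≤ |det|`,
  -- which is the volume bound for the maximal simplex.
  refine ⟨m / V.toReal / (N.factorial * C ^ N) / (2 * N), by positivity, ?_⟩
  rintro Ω ⟨hΩD, ho, hconv, hvol⟩
  have hne : Ω.Nonempty := by
    rw [Set.nonempty_iff_ne_empty]
    rintro rfl
    simp at hvol
    linarith
  have hKD : closure Ω ⊆ D := closure_minimal hΩD hD.isClosed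
  have hKc : IsCompact (closure Ω) := hD.of_isClosed_subset isClosed_closure hKD
  obtain ⟨p₁, hp₁, hd₁⟩ := exists_edgeMatrix_det_ne_zero ho hne
  obtain ⟨p, hp, hmax⟩ := (isCompact_univ_pi fun _ : Fin (N + 1) => hKc).exists_isMaxOn
    ⟨p₁, fun i _ => subset_closure (hp₁ i)⟩ continuous_abs_det_edgeMatrix.continuousOn
  have hp' : ∀ i, p i ∈ closure Ω := fun i => hp i trivial
  have hd0 : 0 < |(edgeMatrix p).det| := (abs_pos.mpr hd₁).trans_le
    (hmax (a := p₁) fun i _ => subset_closure (hp₁ i))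
  have hentry : ∀ i j, |edgeMatrix p i j| ≤ C := by
    intro i j
    simp only [edgeMatrix, Matrix.of_apply]
    have h1 := (PiLp.norm_apply_le (p j.succ) i).trans (hR _ (hKD (hp' j.succ)))
    have h2 := (PiLp.norm_apply_le (p 0) i).trans (hR _ (hKD (hp' 0)))
    rw [Real.norm_eq_abs] at h1 h2
    exact (abs_sub _ _).trans (by linarith)
  have hdm : m / V.toReal ≤ |(edgeMatrix p).det| := by
    have h1 := volume_le_abs_det_edgeMatrix hN (Ω := Ω) (abs_pos.mp hd0) fun x hx j => by
      rw [← edgeMatrix_update_succ]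
      refine hmax (a := Function.update p j.succ x) fun i _ => ?_
      by_cases h : i = j.succ
      · subst h; simpa using subset_closure hx
      · simpa [h] using hp' i
    rw [hvol] at h1
    have h2 := ENNReal.toReal_mono (ENNReal.mul_ne_top ENNReal.ofReal_ne_top hVfin) h1
    rw [ENNReal.toReal_ofReal hm.le, ENNReal.toReal_mul,
      ENNReal.toReal_ofReal (abs_nonneg _)] at h2
    rwa [div_le_iff₀ hVpos]
  obtain ⟨q, hqK⟩ := hconv.closure.ball_subset_of_edgeMatrix hN hp' hC hentry
    (ρ := m / V.toReal / (N.factorial * C ^ N) / (2 * N)) (by positivity)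
    (le_trans (le_of_eq (by field_simp)) hdm)
  refine ⟨q, ?_⟩
  -- The maximal simplex has its vertices only in the closure, but an open convex set is the
  -- interior of its closure.
  have := interior_maximal hqK Metric.isOpen_ball
  rwa [hconv.interior_closure_eq_interior_of_nonempty_interior
    (by rwa [ho.interior_eq]), ho.interior_eq] at this

end ConvexGeometry

/-! ### Compactness of the embedding of `H¹₀(Ω)` into `L²(Ω)`, by averaging over cubes. -/

section Rellich

open scoped ENNReal

variable {N : ℕ}

/-- Cauchy–Schwarz inequality for the integral of a function against `1`. -/
theorem enorm_integral_sq_le {α : Type*} [MeasurableSpace α] {μ : Measure α} {f : α → ℝ}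
    (hf : AEStronglyMeasurable f μ) :
    ‖∫ x, f x ∂μ‖ₑ ^ 2 ≤ μ Set.univ * ∫⁻ x, ‖f x‖ₑ ^ 2 ∂μ := by
  have h1 : ‖∫ x, f x ∂μ‖ₑ ≤ eLpNorm f 1 μ := by
    rw [eLpNorm_one_eq_lintegral_enorm]; exact enorm_integral_le_lintegral_enorm f
  have h2 := eLpNorm_le_eLpNorm_mul_rpow_measure_univ (μ := μ) (p := 1) (q := 2) (by norm_num) hf
  have h3 : eLpNorm f 2 μ ^ 2 = ∫⁻ x, ‖f x‖ₑ ^ 2 ∂μ := by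
    have := eLpNorm_nnreal_pow_eq_lintegral (f := f) (μ := μ) (p := 2) (by norm_num)
    simpa using this
  calc _ ≤ (eLpNorm f 2 μ * μ Set.univ ^ (1 / (1 : ℝ≥0∞).toReal - 1 / (2 : ℝ≥0∞).toReal)) ^ 2 :=
        pow_le_pow_left₀ (by positivity) (h1.trans h2) 2
    _ = _ := by
        rw [mul_pow, h3, mul_comm, ← ENNReal.rpow_natCast, ← ENNReal.rpow_mul]
        norm_num

theorem enorm_gradient {φ : EuclideanSpace ℝ (Fin N) → ℝ} (x : EuclideanSpace ℝ (Fin N)) :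
    ‖∇ φ x‖ₑ = ‖fderiv ℝ φ x‖ₑ := by
  simp [gradient, enorm_eq_nnnorm]

theorem continuous_gradient {φ : EuclideanSpace ℝ (Fin N) → ℝ} (hφ : ContDiff ℝ 1 φ) :
    Continuous fun x => ∇ φ x := by
  unfold gradient
  exact (LinearIsometryEquiv.continuous _).comp (hφ.continuous_fderiv one_ne_zero)

/-- The fundamental theorem of calculus along the segment, followed by Cauchy–Schwarz in `t`. -/
theorem enorm_sub_sq_le_lintegral_segment {φ : EuclideanSpace ℝ (Fin N) → ℝ}
    (hφ : ContDiff ℝ 1 φ) (x z : EuclideanSpace ℝ (Fin N)) :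
    ‖φ (x + z) - φ x‖ₑ ^ 2 ≤ ‖z‖ₑ ^ 2 * ∫⁻ t in Set.Ioc (0 : ℝ) 1, ‖∇ φ (x + t • z)‖ₑ ^ 2 := by
  have hc : Continuous fun t : ℝ => fderiv ℝ φ (x + t • z) z :=
    ((hφ.continuous_fderiv one_ne_zero).comp (by fun_prop)).clm_apply continuous_const
  have hd : ∀ t ∈ Set.uIcc (0 : ℝ) 1,
      HasDerivAt (fun t : ℝ => φ (x + t • z)) (fderiv ℝ φ (x + t • z) z) t := by
    intro t _
    have h1 : HasDerivAt (fun t : ℝ => x + t • z) z t := by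
      simpa using ((hasDerivAt_id t).smul_const z).const_add x
    exact ((hφ.differentiable one_ne_zero _).hasFDerivAt).comp_hasDerivAt t h1
  have hint := intervalIntegral.integral_eq_sub_of_hasDerivAt hd (hc.intervalIntegrable 0 1)
  simp only [one_smul, zero_smul, add_zero] at hint
  rw [← hint, intervalIntegral.integral_of_le zero_le_one]
  refine (enorm_integral_sq_le hc.aestronglyMeasurable).trans ?_
  simp only [Measure.restrict_apply_univ, Real.volume_Ioc, sub_zero, ENNReal.ofReal_one, one_mul]
  rw [← lintegral_const_mul' _ _ (by finiteness)]
  refine lintegral_mono fun t => ?_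
  rw [← mul_pow, mul_comm, enorm_gradient]
  exact pow_le_pow_left₀ (by positivity) (ContinuousLinearMap.le_opENorm _ _) 2

/-- The `L²` modulus of continuity of a `C¹` function is controlled by its gradient. -/
theorem lintegral_translate_sub_sq_le {φ : EuclideanSpace ℝ (Fin N) → ℝ}
    (hφ : ContDiff ℝ 1 φ) (z : EuclideanSpace ℝ (Fin N)) :
    ∫⁻ x, ‖φ (x + z) - φ x‖ₑ ^ 2 ≤ ‖z‖ₑ ^ 2 * ∫⁻ x, ‖∇ φ x‖ₑ ^ 2 := by
  calc _ ≤ ∫⁻ x, ‖z‖ₑ ^ 2 * ∫⁻ t in Set.Ioc (0 : ℝ) 1, ‖∇ φ (x + t • z)‖ₑ ^ 2 :=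
        lintegral_mono fun x => enorm_sub_sq_le_lintegral_segment hφ x z
    _ = ‖z‖ₑ ^ 2 * ∫⁻ x, ∫⁻ t in Set.Ioc (0 : ℝ) 1, ‖∇ φ (x + t • z)‖ₑ ^ 2 :=
        lintegral_const_mul' _ _ (by finiteness)
    _ = ‖z‖ₑ ^ 2 * ∫⁻ t in Set.Ioc (0 : ℝ) 1, ∫⁻ x, ‖∇ φ (x + t • z)‖ₑ ^ 2 := by
        rw [lintegral_lintegral_swap]
        refine Measurable.aemeasurable (Measurable.pow_const (Continuous.measurable ?_) 2)
        refine continuous_enorm.comp ((continuous_gradient hφ).comp ?_)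
        fun_prop
    _ = ‖z‖ₑ ^ 2 * ∫⁻ t in Set.Ioc (0 : ℝ) 1, ∫⁻ x, ‖∇ φ x‖ₑ ^ 2 := by
        congr 2
        ext t
        exact lintegral_add_right_eq_self (fun x => ‖∇ φ x‖ₑ ^ 2) (t • z)
    _ = _ := by simp

/-- The operator of averaging over the cells `Q n`, `n ∈ s`, on `L²(Ω)`. -/
noncomputable def cellAverage (Ω : Set (EuclideanSpace ℝ (Fin N))) {ι : Type*} (s : Finset ι)
    (Q : ι → Set (EuclideanSpace ℝ (Fin N))) (hQ : ∀ n, MeasurableSet (Q n))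
    (hQf : ∀ n, volume.restrict Ω (Q n) ≠ ⊤) :
    Lp ℝ 2 (volume.restrict Ω) →L[ℝ] Lp ℝ 2 (volume.restrict Ω) :=
  ∑ n ∈ s, (volume (Q n)).toReal⁻¹ • (innerSL ℝ (indicatorConstLp 2 (hQ n) (hQf n) (1 : ℝ))).smulRight
    (indicatorConstLp 2 (hQ n) (hQf n) (1 : ℝ))

/-- A finite sum of rank-one operators. -/
theorem isCompactOperator_cellAverage (Ω : Set (EuclideanSpace ℝ (Fin N))) {ι : Type*}
    (s : Finset ι) (Q : ι → Set (EuclideanSpace ℝ (Fin N))) (hQ : ∀ n, MeasurableSet (Q n))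
    (hQf : ∀ n, volume.restrict Ω (Q n) ≠ ⊤) :
    IsCompactOperator (cellAverage Ω s Q hQ hQf) := by
  unfold cellAverage
  refine Submodule.sum_mem (compactOperator (RingHom.id ℝ) _ _) (fun n _ => ?_)
  refine Submodule.smul_mem _ _ ?_
  have h : IsCompactOperator
      (ContinuousLinearMap.toSpanSingleton ℝ (indicatorConstLp 2 (hQ n) (hQf n) (1 : ℝ))) :=
    isCompactOperator_of_locallyCompactSpace_rng _
  exact h.comp_clm (innerSL ℝ (indicatorConstLp 2 (hQ n) (hQf n) (1 : ℝ)))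

/-- Cauchy–Schwarz over the cell. Enlarging the cell to a ball about `x` leaves a bound by
translates of `φ` in which the shape of the cell no longer appears. -/
theorem enorm_sub_average_sq_le {φ : EuclideanSpace ℝ (Fin N) → ℝ} (hφ : Continuous φ)
    (hφc : HasCompactSupport φ) {Q : Set (EuclideanSpace ℝ (Fin N))}
    (hQf : volume Q ≠ ⊤) (hQ0 : volume Q ≠ 0) {r : ℝ} {x : EuclideanSpace ℝ (Fin N)}
    (hr : ∀ y ∈ Q, ‖y - x‖ ≤ r) :
    ‖φ x - (volume Q).toReal⁻¹ * ∫ y in Q, φ y‖ₑ ^ 2 ≤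
      (volume Q)⁻¹ * ∫⁻ z in Metric.closedBall 0 r, ‖φ (x + z) - φ x‖ₑ ^ 2 := by
  have hv : 0 < (volume Q).toReal := ENNReal.toReal_pos hQ0 hQf
  have hfin : IsFiniteMeasure (volume.restrict Q) := ⟨by simpa using hQf.lt_top⟩
  have h1 : φ x - (volume Q).toReal⁻¹ * ∫ y in Q, φ y =
      -((volume Q).toReal⁻¹ * ∫ y in Q, (φ y - φ x)) := by
    rw [integral_sub (hφ.integrable_of_hasCompactSupport hφc).integrableOn (integrable_const _),
      integral_const]
    simp only [Measure.real, Measure.restrict_apply_univ, smul_eq_mul]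
    field_simp
    ring
  rw [h1, enorm_neg, enorm_mul, mul_pow, Real.enorm_of_nonneg (by positivity),
    ENNReal.ofReal_inv_of_pos hv, ENNReal.ofReal_toReal hQf]
  calc _ ≤ (volume Q)⁻¹ ^ 2 * (volume Q * ∫⁻ y in Q, ‖φ y - φ x‖ₑ ^ 2) := by
        gcongr
        have := enorm_integral_sq_le (μ := volume.restrict Q) (f := fun y => φ y - φ x)
          (by fun_prop)
        rwa [Measure.restrict_apply_univ] at this
    _ = (volume Q)⁻¹ * ∫⁻ y in Q, ‖φ y - φ x‖ₑ ^ 2 := by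
        rw [sq, mul_assoc, ← mul_assoc _ (volume Q), ENNReal.inv_mul_cancel hQ0 hQf, one_mul]
    _ ≤ _ := by
        gcongr (volume Q)⁻¹ * ?_
        have h2 : Q ⊆ Metric.closedBall x r := fun y hy => by
          rw [mem_closedBall_iff_norm]; exact hr y hy
        refine (lintegral_mono_set h2).trans (le_of_eq ?_)
        rw [← lintegral_indicator Metric.isClosed_closedBall.measurableSet,
          ← lintegral_indicator Metric.isClosed_closedBall.measurableSet,
          ← lintegral_add_left_eq_self _ x]
        refine lintegral_congr fun z => ?_
        have h3 : x + z ∈ Metric.closedBall x r ↔ z ∈ Metric.closedBall 0 r := by simp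
        by_cases hz : z ∈ Metric.closedBall 0 r
        · rw [Set.indicator_of_mem hz, Set.indicator_of_mem (h3.mpr hz)]
        · rw [Set.indicator_of_notMem hz, Set.indicator_of_notMem (mt h3.mp hz)]

theorem enorm_sq_Lp_eq_lintegral {α F : Type*} [MeasurableSpace α] [NormedAddCommGroup F]
    {μ : Measure α} (f : Lp F 2 μ) : ‖f‖ₑ ^ 2 = ∫⁻ x, ‖f x‖ₑ ^ 2 ∂μ := by
  rw [Lp.enorm_def]
  have := eLpNorm_nnreal_pow_eq_lintegral (f := f) (μ := μ) (p := 2) (by norm_num)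
  simpa using this

/-- The pointwise bound is integrated in `x` and the order of integration exchanged, so that the
`L²` translation estimate applies for each shift `z` of length at most `r`. -/
theorem enorm_sub_cellAverage_sq_le {Ω : Set (EuclideanSpace ℝ (Fin N))}
    (hΩ : MeasurableSet Ω) {ι : Type*}
    {s : Finset ι} {Q : ι → Set (EuclideanSpace ℝ (Fin N))} (hQ : ∀ n, MeasurableSet (Q n))
    (hQf : ∀ n, volume.restrict Ω (Q n) ≠ ⊤) {v : ℝ≥0∞} (hv0 : v ≠ 0) (hv : v ≠ ⊤)
    (hvol : ∀ n, volume (Q n) = v) (hdisj : Pairwise (Function.onFun Disjoint Q))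
    (hcover : ∀ x ∈ Ω, ∃ n ∈ s, x ∈ Q n) {r : ℝ} (hr : ∀ n, ∀ x ∈ Q n, ∀ y ∈ Q n, ‖y - x‖ ≤ r)
    {w : SobolevPair Ω} (hw : w ∈ testPairs Ω) :
    ‖w.fst - cellAverage Ω s Q hQ hQf w.fst‖ₑ ^ 2 ≤
      (v⁻¹ * volume (Metric.closedBall (0 : EuclideanSpace ℝ (Fin N)) r) * ENNReal.ofReal r ^ 2) *
        ‖w.snd‖ₑ ^ 2 := by
  obtain ⟨φ, hφ, h1, h2⟩ := hw
  have hφ1 : ContDiff ℝ 1 φ := hφ.smooth.of_le (by simp)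
  have hcont : Continuous φ := hφ.smooth.continuous
  -- Cells may cross the boundary of `Ω`: extension of `φ` by zero makes the two averages agree, so
  -- no boundary regularity is needed.
  have hint : ∀ n, ∫ x in Q n, w.fst x ∂(volume.restrict Ω) = ∫ x in Q n, φ x := by
    intro n
    rw [integral_congr_ae (ae_restrict_of_ae h1), Measure.restrict_restrict (hQ n)]
    refine (setIntegral_eq_of_subset_of_forall_sdiff_eq_zero (hQ n) Set.inter_subset_left ?_).symm
    intro x hx
    by_contra hne
    exact hx.2 ⟨hx.1, hφ.support_subset (subset_tsupport _ hne)⟩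
  have hae : ∀ᵐ x ∂(volume.restrict Ω), ‖(w.fst - cellAverage Ω s Q hQ hQf w.fst : Lp ℝ 2 _) x‖ₑ ^ 2
      ≤ v⁻¹ * ∫⁻ z in Metric.closedBall 0 r, ‖φ (x + z) - φ x‖ₑ ^ 2 := by
    have hind : ∀ᵐ x ∂(volume.restrict Ω), ∀ n ∈ s,
        ((volume (Q n)).toReal⁻¹ • (innerSL ℝ (indicatorConstLp 2 (hQ n) (hQf n) (1 : ℝ))).smulRight
          (indicatorConstLp 2 (hQ n) (hQf n) (1 : ℝ)) w.fst : Lp ℝ 2 _) x =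
        (Q n).indicator (fun _ => (volume (Q n)).toReal⁻¹ * ∫ y in Q n, φ y) x := by
      refine (ae_ball_iff s.countable_toSet).mpr fun n _ => ?_
      have h3 := indicatorConstLp_coeFn (p := 2) (μ := volume.restrict Ω) (hs := hQ n)
        (hμs := hQf n) (c := (1 : ℝ))
      rw [ContinuousLinearMap.smulRight_apply, innerSL_apply_apply, L2.inner_indicatorConstLp_one,
        hint, smul_smul]
      filter_upwards [h3, Lp.coeFn_smul ((volume (Q n)).toReal⁻¹ * ∫ y in Q n, φ y)
        (indicatorConstLp 2 (hQ n) (hQf n) (1 : ℝ))] with x h3 h4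
      rw [h4, Pi.smul_apply, h3]
      by_cases hx : x ∈ Q n <;> simp [hx]
    have hsum := Lp.coeFn_fun_finsetSum s fun n => ((volume (Q n)).toReal⁻¹ •
      (innerSL ℝ (indicatorConstLp 2 (hQ n) (hQf n) (1 : ℝ))).smulRight
          (indicatorConstLp 2 (hQ n) (hQf n) (1 : ℝ)) w.fst : Lp ℝ 2 (volume.restrict Ω))
    filter_upwards [h1, hind, hsum, Lp.coeFn_sub w.fst (cellAverage Ω s Q hQ hQf w.fst),
      ae_restrict_mem hΩ] with x h1 hind hsum hsub hx
    obtain ⟨n, hn, hxn⟩ := hcover x hx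
    have hP : (cellAverage Ω s Q hQ hQf w.fst : Lp ℝ 2 _) x =
        (volume (Q n)).toReal⁻¹ * ∫ y in Q n, φ y := by
      simp only [cellAverage, _root_.sum_apply, _root_.smul_apply]
      rw [hsum, Finset.sum_eq_single n]
      · rw [hind n hn, Set.indicator_of_mem hxn]
      · intro m hm hmn
        rw [hind m hm, Set.indicator_of_notMem]
        exact fun hxm => (Set.disjoint_left.mp (hdisj hmn) hxm) hxn
      · exact fun h => absurd hn h
    rw [hsub, Pi.sub_apply, hP, h1]
    have := enorm_sub_average_sq_le hcont hφ.compact (Q := Q n) (by rwa [hvol]) (by rwa [hvol])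
      (x := x) (r := r) (hr n x hxn)
    rwa [hvol n] at this ⊢
  rw [enorm_sq_Lp_eq_lintegral, enorm_sq_Lp_eq_lintegral]
  calc _ ≤ ∫⁻ x in Ω, v⁻¹ * ∫⁻ z in Metric.closedBall 0 r, ‖φ (x + z) - φ x‖ₑ ^ 2 :=
        lintegral_mono_ae hae
    _ ≤ ∫⁻ x, v⁻¹ * ∫⁻ z in Metric.closedBall 0 r, ‖φ (x + z) - φ x‖ₑ ^ 2 :=
        setLIntegral_le_lintegral _ _
    _ = v⁻¹ * ∫⁻ z in Metric.closedBall 0 r, ∫⁻ x, ‖φ (x + z) - φ x‖ₑ ^ 2 := by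
        rw [lintegral_const_mul' _ _ (ENNReal.inv_ne_top.mpr hv0), lintegral_lintegral_swap]
        refine Measurable.aemeasurable (Measurable.pow_const (Continuous.measurable ?_) 2)
        refine continuous_enorm.comp ?_
        fun_prop
    _ ≤ v⁻¹ * ∫⁻ z in Metric.closedBall (0 : EuclideanSpace ℝ (Fin N)) r,
          (ENNReal.ofReal r ^ 2 * ∫⁻ x, ‖∇ φ x‖ₑ ^ 2) := by
        gcongr v⁻¹ * ?_
        refine setLIntegral_mono' Metric.isClosed_closedBall.measurableSet fun z hz => ?_
        refine (lintegral_translate_sub_sq_le hφ1 z).trans ?_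
        gcongr
        rw [mem_closedBall_zero_iff] at hz
        rw [← ofReal_norm]
        exact ENNReal.ofReal_le_ofReal hz
    _ = v⁻¹ * volume (Metric.closedBall (0 : EuclideanSpace ℝ (Fin N)) r) * ENNReal.ofReal r ^ 2 *
          ∫⁻ x, ‖∇ φ x‖ₑ ^ 2 := by
        rw [lintegral_const, Measure.restrict_apply_univ]; ring
    _ = _ := by
        congr 1
        refine Eq.trans ?_ (lintegral_congr_ae (f := fun x => ‖∇ φ x‖ₑ ^ 2)
          (h2.mono fun x hx => by simp only [hx]))
        refine (setLIntegral_eq_of_support_subset fun x hx => ?_).symm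
        refine hφ.support_subset (support_fderiv_subset ℝ (f := φ) fun h0 => hx ?_)
        simp [gradient, h0]

/-- The half-open cubes of side `h` of the grid `h ℤᴺ`. -/
def gridCell (h : ℝ) (n : Fin N → ℤ) : Set (EuclideanSpace ℝ (Fin N)) :=
  {x | ∀ i, ⌊x i / h⌋ = n i}

theorem measurableSet_gridCell (h : ℝ) (n : Fin N → ℤ) : MeasurableSet (gridCell h n) := by
  have : gridCell h n = ⋂ i, (fun x : EuclideanSpace ℝ (Fin N) => ⌊x i / h⌋) ⁻¹' {n i} := by
    ext x; simp [gridCell]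
  rw [this]
  refine MeasurableSet.iInter fun i => ?_
  have hm : Measurable fun x : EuclideanSpace ℝ (Fin N) => ⌊x i / h⌋ := by
    refine Int.measurable_floor.comp (Continuous.measurable ?_)
    fun_prop
  exact hm (measurableSet_singleton _)

theorem mem_gridCell_iff {h : ℝ} (hh : 0 < h) {n : Fin N → ℤ} {x : EuclideanSpace ℝ (Fin N)} :
    x ∈ gridCell h n ↔ ∀ i, x i ∈ Set.Ico (n i * h) (n i * h + h) := by
  refine forall_congr' fun i => ?_
  rw [Int.floor_eq_iff, le_div_iff₀ hh, div_lt_iff₀ hh, add_mul, one_mul, Set.mem_Ico]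

theorem volume_gridCell {h : ℝ} (hh : 0 < h) (n : Fin N → ℤ) :
    volume (gridCell h n) = ENNReal.ofReal h ^ N := by
  have : gridCell h n = (WithLp.ofLp : EuclideanSpace ℝ (Fin N) → (Fin N → ℝ)) ⁻¹'
      (Set.univ.pi fun i => Set.Ico (n i * h) (n i * h + h)) := by
    ext x; simp [mem_gridCell_iff hh]
  rw [this, (PiLp.volume_preserving_ofLp (Fin N)).measure_preimage
    (MeasurableSet.univ_pi fun _ => measurableSet_Ico).nullMeasurableSet, volume_pi_pi]
  simp

theorem norm_sub_le_of_mem_gridCell {h : ℝ} (hh : 0 < h) {n : Fin N → ℤ}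
    {x y : EuclideanSpace ℝ (Fin N)} (hx : x ∈ gridCell h n) (hy : y ∈ gridCell h n) :
    ‖y - x‖ ≤ N * h := by
  rw [mem_gridCell_iff hh] at hx hy
  rw [EuclideanSpace.norm_eq]
  refine Real.sqrt_le_iff.mpr ⟨by positivity, ?_⟩
  calc _ ≤ ∑ _j : Fin N, h ^ 2 := by
        refine Finset.sum_le_sum fun j _ => ?_
        refine pow_le_pow_left₀ (norm_nonneg _) ?_ 2
        rw [Real.norm_eq_abs, abs_le, PiLp.sub_apply]
        have h1 := hx j
        have h2 := hy j
        constructor <;> linarith [h1.1, h1.2, h2.1, h2.2]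
    _ = N * h ^ 2 := by simp
    _ ≤ (N * h) ^ 2 := by
        rw [mul_pow]
        refine mul_le_mul_of_nonneg_right ?_ (by positivity)
        exact_mod_cast Nat.le_self_pow two_ne_zero N

theorem exists_finset_gridCell_cover {h : ℝ} (hh : 0 < h) {Ω : Set (EuclideanSpace ℝ (Fin N))}
    (hΩ : Bornology.IsBounded Ω) :
    ∃ s : Finset (Fin N → ℤ), ∀ x ∈ Ω, ∃ n ∈ s, x ∈ gridCell h n := by
  obtain ⟨R, hR⟩ := hΩ.exists_norm_le
  refine ⟨Fintype.piFinset fun _ => Finset.Icc ⌊-R / h⌋ ⌊R / h⌋, fun x hx =>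
    ⟨fun i => ⌊x i / h⌋, ?_, fun i => rfl⟩⟩
  rw [Fintype.mem_piFinset]
  intro i
  have h1 := abs_le.mp (((PiLp.norm_apply_le x i).trans (hR x hx)))
  rw [Finset.mem_Icc]
  exact ⟨Int.floor_le_floor (by gcongr; exact h1.1), Int.floor_le_floor (by gcongr; exact h1.2)⟩

theorem exists_compact_approximation {Ω : Set (EuclideanSpace ℝ (Fin N))}
    (hΩ : MeasurableSet Ω) (hb : Bornology.IsBounded Ω) :
    ∃ K : ℝ, ∀ h > 0, ∃ P : Lp ℝ 2 (volume.restrict Ω) →L[ℝ] Lp ℝ 2 (volume.restrict Ω),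
      IsCompactOperator P ∧ ∀ w ∈ H10 Ω, ‖w.fst - P w.fst‖ ≤ K * h * ‖w.snd‖ := by
  set V : ℝ≥0∞ := volume (Metric.ball (0 : EuclideanSpace ℝ (Fin N)) 1)
  have hV : V ≠ ⊤ := measure_ball_lt_top.ne
  refine ⟨√((N : ℝ) ^ N * V.toReal * (N : ℝ) ^ 2), fun h hh => ?_⟩
  obtain ⟨s, hs⟩ := exists_finset_gridCell_cover hh hb
  have hQf : ∀ n : Fin N → ℤ, volume.restrict Ω (gridCell h n) ≠ ⊤ := fun n => by
    refine ne_top_of_le_ne_top ?_ (Measure.restrict_apply_le _ _)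
    rw [volume_gridCell hh]
    finiteness
  refine ⟨cellAverage Ω s (gridCell h) (measurableSet_gridCell h) hQf,
    isCompactOperator_cellAverage _ _ _ _ _, ?_⟩
  set P := cellAverage Ω s (gridCell h) (measurableSet_gridCell h) hQf
  have hdisj : Pairwise (Function.onFun Disjoint (gridCell (N := N) h)) := by
    intro m n hmn
    refine Set.disjoint_left.mpr fun x hx hy => hmn (funext fun i => ?_)
    rw [← hx i, ← hy i]
  have hv0 : ENNReal.ofReal h ^ N ≠ 0 := pow_ne_zero _ (by simpa using hh)
  have hvt : ENNReal.ofReal h ^ N ≠ ⊤ := by finiteness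
  -- The cell volume `hᴺ` cancels against the volume `(N h)ᴺ V` of the ball, leaving a bound of
  -- order `h²`.
  have hconst : (ENNReal.ofReal h ^ N)⁻¹ *
      volume (Metric.closedBall (0 : EuclideanSpace ℝ (Fin N)) (N * h)) *
      ENNReal.ofReal (N * h) ^ 2 =
      ENNReal.ofReal ((√((N : ℝ) ^ N * V.toReal * (N : ℝ) ^ 2) * h) ^ 2) := by
    rw [Measure.addHaar_closedBall _ _ (by positivity), finrank_euclideanSpace_fin, mul_pow,
      ENNReal.ofReal_mul (by positivity), mul_pow (√_), Real.sq_sqrt (by positivity),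
      ENNReal.ofReal_mul (by positivity), ENNReal.ofReal_mul (by positivity),
      ENNReal.ofReal_mul (by positivity), ENNReal.ofReal_mul (by positivity),
      ENNReal.ofReal_toReal hV, ENNReal.ofReal_pow hh.le, ENNReal.ofReal_pow hh.le,
      ENNReal.ofReal_pow (by positivity), ENNReal.ofReal_pow (by positivity)]
    calc _ = ((ENNReal.ofReal h ^ N)⁻¹ * ENNReal.ofReal h ^ N) *
          (ENNReal.ofReal N ^ N * V * (ENNReal.ofReal N * ENNReal.ofReal h) ^ 2) := by ring
      _ = _ := by rw [ENNReal.inv_mul_cancel hv0 hvt]; ring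
  -- The estimate is a closed condition, so it passes from test functions to their closure.
  have hclosed : IsClosed {w : SobolevPair Ω | ‖w.fst - P w.fst‖ ≤
      √((N : ℝ) ^ N * V.toReal * (N : ℝ) ^ 2) * h * ‖w.snd‖} := by
    have hf : Continuous fun w : SobolevPair Ω => w.fst := (WithLp.fstL 2 ℝ _ _).continuous
    have hg : Continuous fun w : SobolevPair Ω => w.snd := (WithLp.sndL 2 ℝ _ _).continuous
    exact isClosed_le (hf.sub (P.continuous.comp hf)).norm (continuous_const.mul hg.norm)
  refine fun w hw => closure_minimal (fun w hw => ?_) hclosed hw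
  have key := enorm_sub_cellAverage_sq_le hΩ (measurableSet_gridCell h) hQf hv0 hvt
    (volume_gridCell hh) hdisj hs (r := N * h)
    (fun n x hx y hy => norm_sub_le_of_mem_gridCell hh hx hy) hw
  rw [hconst, ← ofReal_norm, ← ofReal_norm, ← ENNReal.ofReal_pow (norm_nonneg _),
    ← ENNReal.ofReal_pow (norm_nonneg _), ← ENNReal.ofReal_mul (by positivity), ← mul_pow,
    ENNReal.ofReal_le_ofReal_iff (by positivity)] at key
  exact (pow_le_pow_iff_left₀ (norm_nonneg _) (by positivity) two_ne_zero).mp key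

/-- The **Rellich–Kondrachov theorem**: `H¹₀(Ω)` embeds compactly into `L²(Ω)`. -/
theorem isCompactOperator_fst_H10 {Ω : Set (EuclideanSpace ℝ (Fin N))}
    (hΩ : MeasurableSet Ω) (hb : Bornology.IsBounded Ω) :
    IsCompactOperator ((WithLp.fstL 2 ℝ (Lp ℝ 2 (volume.restrict Ω))
      (Lp (EuclideanSpace ℝ (Fin N)) 2 (volume.restrict Ω))).comp (H10 Ω).subtypeL) := by
  obtain ⟨K, hK⟩ := exists_compact_approximation hΩ hb
  set J := (WithLp.fstL 2 ℝ (Lp ℝ 2 (volume.restrict Ω))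
      (Lp (EuclideanSpace ℝ (Fin N)) 2 (volume.restrict Ω))).comp (H10 Ω).subtypeL
  choose P hPc hP using fun n : ℕ => hK (1 / ((n : ℝ) + 1)) (by positivity)
  have hlim : Tendsto (fun n => (P n).comp J) atTop (𝓝 J) := by
    refine (tendsto_iff_norm_sub_tendsto_zero
      (E := H10 Ω →L[ℝ] Lp ℝ 2 (volume.restrict Ω))).mpr ?_
    refine squeeze_zero (g := fun n : ℕ => |K| * (1 / ((n : ℝ) + 1))) (fun n =>
      ContinuousLinearMap.opNorm_nonneg _) (fun n => ?_) ?_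
    · refine ContinuousLinearMap.opNorm_le_bound _ (by positivity) fun w => ?_
      rw [_root_.sub_apply, norm_sub_rev]
      refine (hP n w.1 w.2).trans ?_
      have h1 : ‖(w.1).snd‖ ≤ ‖w‖ := WithLp.norm_snd_le _ _
      gcongr
      exact le_abs_self K
    · simpa using (tendsto_one_div_add_atTop_nhds_zero_nat (𝕜 := ℝ)).const_mul |K|
  exact isCompactOperator_of_tendsto hlim (Eventually.of_forall fun n => (hPc n).comp_clm J)

end Rellich

/-! ### Min-max for generalized eigenvalues of a pair of quadratic forms. -/

section SpectralLevels

variable {E F : Type*} [NormedAddCommGroup E] [InnerProductSpace ℝ E]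
  [NormedAddCommGroup F] [InnerProductSpace ℝ F]

open scoped InnerProductSpace

/-- On the span of generalized eigenvectors with eigenvalues at most `τ` the quadratic form
`‖x‖² - τ ‖J x‖²` is nonpositive. -/
theorem norm_sq_sum_eigenvectors_le (J : E →L[ℝ] F) {ι : Type*} [Fintype ι] {u : ι → E}
    {σ : ι → ℝ} {τ : ℝ} (hσ : ∀ i, σ i ≤ τ) (hu : ∀ i v, ⟪u i, v⟫_ℝ = σ i * ⟪J (u i), J v⟫_ℝ)
    (c : ι → ℝ) : ‖∑ i, c i • u i‖ ^ 2 ≤ τ * ‖J (∑ i, c i • u i)‖ ^ 2 := by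
  -- Eigenvectors with different eigenvalues have orthogonal images under `J`, so the weight `τ - σ
  -- i` may be split symmetrically. This exhibits `τ ‖J x‖² - ‖x‖²` as the square `‖∑ c i √(τ - σ i)
  -- J (u i)‖²`.
  have hsymm : ∀ i j, √(τ - σ i) * √(τ - σ j) * ⟪J (u i), J (u j)⟫_ℝ =
      (τ - σ i) * ⟪J (u i), J (u j)⟫_ℝ := by
    intro i j
    by_cases h : σ i = σ j
    · rw [h, Real.mul_self_sqrt (sub_nonneg.mpr (hσ j))]
    · have h1 := hu i (u j)
      have h2 := hu j (u i)
      rw [real_inner_comm, real_inner_comm (J (u i))] at h2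
      have h3 : (σ i - σ j) * ⟪J (u i), J (u j)⟫_ℝ = 0 := by linarith
      rcases mul_eq_zero.mp h3 with h4 | h4
      · exact absurd (sub_eq_zero.mp h4) h
      · rw [h4, mul_zero, mul_zero]
  have hnonneg : 0 ≤ ‖∑ i, (c i * √(τ - σ i)) • J (u i)‖ ^ 2 := sq_nonneg _
  have e1 : ‖∑ i, (c i * √(τ - σ i)) • J (u i)‖ ^ 2 =
      ∑ i, ∑ j, c i * c j * ((τ - σ i) * ⟪J (u i), J (u j)⟫_ℝ) := by
    rw [← real_inner_self_eq_norm_sq, sum_inner]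
    refine Finset.sum_congr rfl fun i _ => ?_
    rw [inner_sum]
    refine Finset.sum_congr rfl fun j _ => ?_
    rw [real_inner_smul_left, real_inner_smul_right, ← hsymm]
    ring
  have e2 : ‖J (∑ i, c i • u i)‖ ^ 2 = ∑ i, ∑ j, c i * c j * ⟪J (u i), J (u j)⟫_ℝ := by
    rw [← real_inner_self_eq_norm_sq, map_sum, sum_inner]
    refine Finset.sum_congr rfl fun i _ => ?_
    rw [inner_sum]
    refine Finset.sum_congr rfl fun j _ => ?_
    rw [map_smul, map_smul, real_inner_smul_left, real_inner_smul_right]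
    ring
  have e3 : ‖∑ i, c i • u i‖ ^ 2 = ∑ i, ∑ j, c i * c j * (σ i * ⟪J (u i), J (u j)⟫_ℝ) := by
    rw [← real_inner_self_eq_norm_sq, sum_inner]
    refine Finset.sum_congr rfl fun i _ => ?_
    rw [inner_sum]
    refine Finset.sum_congr rfl fun j _ => ?_
    rw [real_inner_smul_left, real_inner_smul_right, hu]
    ring
  have e4 : ‖∑ i, (c i * √(τ - σ i)) • J (u i)‖ ^ 2 =
      τ * ‖J (∑ i, c i • u i)‖ ^ 2 - ‖∑ i, c i • u i‖ ^ 2 := by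
    rw [e1, e2, e3, Finset.mul_sum, ← Finset.sum_sub_distrib]
    refine Finset.sum_congr rfl fun i _ => ?_
    rw [Finset.mul_sum, ← Finset.sum_sub_distrib]
    refine Finset.sum_congr rfl fun j _ => ?_
    ring
  linarith

theorem abs_le_norm_sum_of_orthonormal {ι : Type*} [Fintype ι] {e : ι → E}
    (he : Orthonormal ℝ e) (c : ι → ℝ) (i : ι) : |c i| ≤ ‖∑ i, c i • e i‖ := by
  classical
  rw [← he.inner_right_fintype c i]
  exact (abs_real_inner_le_norm _ _).trans (by rw [he.1, one_mul])

/-- Approximation of the span of singular vectors by a dense subspace. -/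
theorem exists_approx_of_singular_system (J : E →L[ℝ] F) (hJ1 : ∀ x, ‖J x‖ ≤ ‖x‖) {n : ℕ}
    {e : Fin n → E} {μ : Fin n → ℝ} {ν : ℝ} (hν : 0 < ν) (he : Orthonormal ℝ e)
    (hμ : ∀ i, ν ≤ μ i) (hJe : ∀ i v, ⟪J (e i), J v⟫_ℝ = μ i * ⟪e i, v⟫_ℝ) {S : Set E}
    (hS : Dense S) {τ : ℝ} (hτ : ν⁻¹ < τ) :
    ∃ w : Fin n → E, (∀ i, w i ∈ S) ∧ ∀ c : Fin n → ℝ, c ≠ 0 →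
      0 < ‖J (∑ i, c i • w i)‖ ^ 2 ∧ ‖∑ i, c i • w i‖ ^ 2 ≤ τ * ‖J (∑ i, c i • w i)‖ ^ 2 := by
  -- At `η = 0` the second inequality is `1 < τ ν`; it persists for small `η` by continuity.
  obtain ⟨η, hη0, hην, hητ⟩ : ∃ η > 0, η < √ν ∧ (1 + η) ^ 2 < τ * (√ν - η) ^ 2 := by
    have h1 : ∀ᶠ η : ℝ in 𝓝 0, (1 + η) ^ 2 < τ * (√ν - η) ^ 2 := by
      refine ContinuousAt.eventually_lt (by fun_prop) (by fun_prop) ?_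
      rw [add_zero, sub_zero, Real.sq_sqrt hν.le, one_pow]
      rwa [inv_lt_iff_one_lt_mul₀ hν] at hτ
    have h2 : ∀ᶠ η : ℝ in 𝓝 0, η < √ν := eventually_lt_nhds (Real.sqrt_pos.mpr hν)
    have h3 : ∀ᶠ η : ℝ in 𝓝[>] 0, 0 < η := eventually_mem_nhdsWithin
    obtain ⟨η, ⟨a, b⟩, c⟩ := (((h2.and h1).filter_mono nhdsWithin_le_nhds).and h3).exists
    exact ⟨η, c, a, b⟩
  -- Each of the `n` approximations then costs at most `‖x‖ η / (n + 1)`; the `+ 1` also covers `n =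
  -- 0`.
  have hδ : 0 < η / (n + 1) := by positivity
  choose w hwS hw using fun i => hS.exists_dist_lt (e i) hδ
  refine ⟨w, hwS, fun c hc => ?_⟩
  set x := ∑ i, c i • e i with hx
  set y := ∑ i, c i • w i with hy
  have hxpos : 0 < ‖x‖ := by
    obtain ⟨i, hi⟩ := Function.ne_iff.mp hc
    exact (abs_pos.mpr hi).trans_le (abs_le_norm_sum_of_orthonormal he c i)
  have hyx : ‖y - x‖ ≤ η * ‖x‖ := by
    rw [hy, hx, ← Finset.sum_sub_distrib]
    calc _ ≤ ∑ i : Fin n, ‖c i • w i - c i • e i‖ := norm_sum_le _ _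
      _ ≤ ∑ _i : Fin n, ‖x‖ * (η / (n + 1)) := by
          refine Finset.sum_le_sum fun i _ => ?_
          rw [← smul_sub, norm_smul]
          have := (hw i).le
          rw [dist_comm, dist_eq_norm] at this
          exact mul_le_mul (abs_le_norm_sum_of_orthonormal he c i) this (norm_nonneg _)
            (norm_nonneg _)
      _ = ‖x‖ * η * (n / (n + 1)) := by simp; ring
      _ ≤ ‖x‖ * η * 1 := by
          gcongr
          exact div_le_one_of_le₀ (by linarith) (by positivity)
      _ = η * ‖x‖ := by ring
  have hJx : √ν * ‖x‖ ≤ ‖J x‖ := by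
    have h1 : ‖J x‖ ^ 2 = ∑ i, μ i * c i ^ 2 := by
      have h0 : J x = ∑ i, c i • J (e i) := by simp [hx]
      rw [← real_inner_self_eq_norm_sq]
      conv_lhs => arg 2; rw [h0]
      rw [sum_inner]
      refine Finset.sum_congr rfl fun i _ => ?_
      rw [real_inner_smul_left, hJe, he.inner_right_fintype c i]
      ring
    have h2 : ‖x‖ ^ 2 = ∑ i, c i ^ 2 := by
      rw [← real_inner_self_eq_norm_sq]
      nth_rewrite 1 [hx]
      rw [sum_inner]
      refine Finset.sum_congr rfl fun i _ => ?_
      rw [real_inner_smul_left, he.inner_right_fintype c i]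
      ring
    refine (pow_le_pow_iff_left₀ (by positivity) (norm_nonneg _) two_ne_zero).mp ?_
    rw [mul_pow, Real.sq_sqrt hν.le, h1, h2, Finset.mul_sum]
    exact Finset.sum_le_sum fun i _ => mul_le_mul_of_nonneg_right (hμ i) (sq_nonneg _)
  have hJy : (√ν - η) * ‖x‖ ≤ ‖J y‖ := by
    have h1 : ‖J x‖ ≤ ‖J y‖ + ‖J (y - x)‖ := by
      rw [map_sub, ← norm_sub_rev]
      exact norm_le_insert' _ _
    have h2 := (hJ1 (y - x)).trans hyx
    linarith
  have hy1 : ‖y‖ ≤ (1 + η) * ‖x‖ := by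
    have := norm_le_insert' y x
    linarith
  have hpos : 0 < (√ν - η) * ‖x‖ := mul_pos (by linarith) hxpos
  have hτ0 : 0 < τ := (inv_pos.mpr hν).trans hτ
  refine ⟨by have := hpos.trans_le hJy; positivity, ?_⟩
  calc ‖y‖ ^ 2 ≤ ((1 + η) * ‖x‖) ^ 2 := pow_le_pow_left₀ (norm_nonneg _) hy1 2
    _ = (1 + η) ^ 2 * ‖x‖ ^ 2 := by ring
    _ ≤ τ * (√ν - η) ^ 2 * ‖x‖ ^ 2 := by gcongr
    _ = τ * ((√ν - η) * ‖x‖) ^ 2 := by ring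
    _ ≤ τ * ‖J y‖ ^ 2 := by gcongr

/-- The `(n+1)`-st generalized eigenvalue `τ` of the pair of forms `‖x‖²`, `‖J x‖²`: it is reached
by eigenvectors, and is the min-max value, also over a dense subspace. -/
theorem IsCompactOperator.exists_generalized_eigenvalue [CompleteSpace E] [CompleteSpace F]
    (J : E →L[ℝ] F) (hJ : IsCompactOperator J) (hJ1 : ∀ x, ‖J x‖ ≤ ‖x‖)
    (hrank : ∀ k, ∃ w : Fin k → E, LinearIndependent ℝ (fun i => J (w i))) {S : Set E}
    (hS : Dense S) (n : ℕ) :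
    ∃ τ : ℝ, 1 ≤ τ ∧
      (∃ u : Fin (n + 1) → E, LinearIndependent ℝ u ∧
        ∀ i, ∃ σ ≤ τ, ∀ v, ⟪u i, v⟫_ℝ = σ * ⟪J (u i), J v⟫_ℝ) ∧
      (∀ (w : Fin (n + 1) → E) (τ' : ℝ), LinearIndependent ℝ w →
        (∀ c : Fin (n + 1) → ℝ, ‖∑ i, c i • w i‖ ^ 2 ≤ τ' * ‖J (∑ i, c i • w i)‖ ^ 2) →
        τ ≤ τ') ∧
      ∀ τ' > τ, ∃ w : Fin (n + 1) → E, (∀ i, w i ∈ S) ∧ ∀ c : Fin (n + 1) → ℝ, c ≠ 0 →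
        0 < ‖J (∑ i, c i • w i)‖ ^ 2 ∧
          ‖∑ i, c i • w i‖ ^ 2 ≤ τ' * ‖J (∑ i, c i • w i)‖ ^ 2 := by
  obtain ⟨e, μ, ho, hν, hμ, he, hmm⟩ := hJ.exists_singular_minmax J hrank n
  set ν := μ (Fin.last n)
  refine ⟨ν⁻¹, ?_, ⟨e, ho.linearIndependent, fun i => ⟨(μ i)⁻¹, inv_anti₀ hν (hμ i), fun v => ?_⟩⟩,
    fun w τ' hw h => ?_, fun τ' hτ' => ?_⟩
  · have h1 := he (Fin.last n) (e (Fin.last n))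
    rw [real_inner_self_eq_norm_sq, real_inner_self_eq_norm_sq, ho.1] at h1
    have h2 := pow_le_pow_left₀ (norm_nonneg _) (hJ1 (e (Fin.last n))) 2
    rw [ho.1] at h2
    exact (one_le_inv₀ hν).mpr (by linarith)
  · rw [he, inv_mul_cancel_left₀ (hν.trans_le (hμ i)).ne']
  · obtain ⟨c, hc0, hc⟩ := hmm w
    have hne : ∑ i, c i • w i ≠ 0 := fun h0 =>
      hc0 (funext (Fintype.linearIndependent_iff.mp hw c h0))
    have h1 : 0 < ‖∑ i, c i • w i‖ ^ 2 := by have := norm_pos_iff.mpr hne; positivity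
    have h2 := h c
    have hτ0 : 0 < τ' := by
      by_contra hle
      nlinarith [sq_nonneg ‖J (∑ i, c i • w i)‖]
    rw [inv_le_iff_one_le_mul₀ hν]
    have h3 : ‖∑ i, c i • w i‖ ^ 2 ≤ τ' * ν * ‖∑ i, c i • w i‖ ^ 2 :=
      h2.trans (by rw [mul_assoc]; exact mul_le_mul_of_nonneg_left hc hτ0.le)
    exact le_of_mul_le_mul_right (by simpa using h3) h1
  · exact exists_approx_of_singular_system J hJ1 hν ho hμ he hS hτ'

end SpectralLevels

/-! ### `H¹₀(Ω)` with the energy inner product, and weak solutions as generalized eigenvectors. -/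

section EnergySpace

open scoped InnerProductSpace

variable {N : ℕ}

open scoped MatrixOrder Matrix.Norms.L2Operator in
/-- A positive definite matrix is the Gram matrix of a linear automorphism. -/
theorem Matrix.PosDef.exists_continuousLinearEquiv {A : Matrix (Fin N) (Fin N) ℝ} (hA : A.PosDef) :
    ∃ T : EuclideanSpace ℝ (Fin N) ≃L[ℝ] EuclideanSpace ℝ (Fin N),
      ∀ p q, ⟪T p, T q⟫_ℝ = ∑ i, ∑ j, A i j * p j * q i := by
  obtain ⟨B, hBu, hB⟩ := CStarAlgebra.isStrictlyPositive_iff_eq_star_mul_self.mp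
    hA.isStrictlyPositive
  have hdet : IsUnit B.det := (Matrix.isUnit_iff_isUnit_det B).mp hBu
  let e : EuclideanSpace ℝ (Fin N) ≃ₗ[ℝ] EuclideanSpace ℝ (Fin N) :=
    LinearEquiv.ofLinearMap (Matrix.toEuclideanLin B) (Matrix.toEuclideanLin B⁻¹)
      (by ext x i; simp [Matrix.toLpLin_apply, Matrix.mulVec_mulVec, Matrix.mul_nonsing_inv B hdet])
      (by ext x i; simp [Matrix.toLpLin_apply, Matrix.mulVec_mulVec, Matrix.nonsing_inv_mul B hdet])
  refine ⟨e.toContinuousLinearEquiv, fun p q => ?_⟩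
  have h1 : ∀ p, e.toContinuousLinearEquiv p = WithLp.toLp 2 (B.mulVec p.ofLp) := fun p => rfl
  rw [h1, h1, EuclideanSpace.inner_toLp_toLp]
  have h2 : ∑ i, ∑ j, A i j * p j * q i = q.ofLp ⬝ᵥ (A.mulVec p.ofLp) := by
    simp only [dotProduct, Matrix.mulVec, Finset.mul_sum]
    exact Finset.sum_congr rfl fun i _ => Finset.sum_congr rfl fun j _ => by ring
  rw [h2, hB, ← Matrix.mulVec_mulVec, Matrix.dotProduct_mulVec]
  simp [Matrix.star_eq_conjTranspose, Matrix.conjTranspose_eq_transpose_of_trivial,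
    Matrix.vecMul_transpose, dotProduct_comm]

/-- The map `(u, p) ↦ (u, T p)` on `L²(Ω) × L²(Ω; ℝᴺ)`. -/
noncomputable def energyMap (Ω : Set (EuclideanSpace ℝ (Fin N)))
    (T : EuclideanSpace ℝ (Fin N) →L[ℝ] EuclideanSpace ℝ (Fin N)) :
    SobolevPair Ω →L[ℝ] SobolevPair Ω :=
  (WithLp.prodContinuousLinearEquiv 2 ℝ (Lp ℝ 2 (volume.restrict Ω))
    (Lp (EuclideanSpace ℝ (Fin N)) 2 (volume.restrict Ω))).symm.toContinuousLinearMap.comp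
    ((WithLp.fstL 2 ℝ _ _).prod
      ((ContinuousLinearMap.compLpL 2 (volume.restrict Ω) T).comp (WithLp.sndL 2 ℝ _ _)))

variable {Ω : Set (EuclideanSpace ℝ (Fin N))}

theorem energyMap_snd (T : EuclideanSpace ℝ (Fin N) →L[ℝ] EuclideanSpace ℝ (Fin N))
    (w : SobolevPair Ω) :
    (energyMap Ω T w).snd = ContinuousLinearMap.compLpL 2 (volume.restrict Ω) T w.snd := rfl

theorem energyMap_energyMap_of_leftInverse
    {T S : EuclideanSpace ℝ (Fin N) →L[ℝ] EuclideanSpace ℝ (Fin N)} (h : ∀ x, S (T x) = x)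
    (w : SobolevPair Ω) : energyMap Ω S (energyMap Ω T w) = w := by
  have h2 : (energyMap Ω S (energyMap Ω T w)).snd = w.snd := by
    rw [energyMap_snd, energyMap_snd]
    apply Lp.ext
    filter_upwards [S.coeFn_compLpL (p := 2) (μ := volume.restrict Ω)
        (ContinuousLinearMap.compLpL 2 (volume.restrict Ω) T w.snd),
      T.coeFn_compLpL (p := 2) (μ := volume.restrict Ω) w.snd] with x h1 h2
    rw [h1, h2, h]
  exact WithLp.ofLp_injective 2 (Prod.ext rfl h2)

theorem inner_energyMap {A : Matrix (Fin N) (Fin N) ℝ}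
    {T : EuclideanSpace ℝ (Fin N) →L[ℝ] EuclideanSpace ℝ (Fin N)}
    (hT : ∀ p q, ⟪T p, T q⟫_ℝ = ∑ i, ∑ j, A i j * p j * q i) (u v : SobolevPair Ω) :
    ⟪energyMap Ω T u, energyMap Ω T v⟫_ℝ =
      (∫ x in Ω, ∑ i, ∑ j, A i j * u.snd x j * v.snd x i) + ∫ x in Ω, u.fst x * v.fst x := by
  rw [WithLp.prod_inner_apply, L2.inner_def, L2.inner_def, add_comm]
  congr 1
  · refine integral_congr_ae ?_
    filter_upwards [T.coeFn_compLpL (p := 2) (μ := volume.restrict Ω) u.snd,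
      T.coeFn_compLpL (p := 2) (μ := volume.restrict Ω) v.snd] with x h1 h2
    rw [← hT, ← h1, ← h2]
    rfl
  · refine integral_congr_ae (Eventually.of_forall fun x => ?_)
    exact mul_comm _ _

/-- The space `H¹₀(Ω)`, carried by the map `energyMap`. -/
noncomputable def energySpace (Ω : Set (EuclideanSpace ℝ (Fin N)))
    (T : EuclideanSpace ℝ (Fin N) ≃L[ℝ] EuclideanSpace ℝ (Fin N)) : Submodule ℝ (SobolevPair Ω) :=
  (H10 Ω).comap (energyMap Ω (T.symm : EuclideanSpace ℝ (Fin N) →L[ℝ] EuclideanSpace ℝ (Fin N)) :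
    SobolevPair Ω →ₗ[ℝ] SobolevPair Ω)

variable (T : EuclideanSpace ℝ (Fin N) ≃L[ℝ] EuclideanSpace ℝ (Fin N))

/-- The space is a preimage of the closed subspace `H10 Ω` under a continuous map. -/
instance : CompleteSpace (energySpace Ω T) := by
  have h : IsClosed (H10 Ω : Set (SobolevPair Ω)) := Submodule.isClosed_topologicalClosure _
  exact (h.preimage (energyMap Ω _).continuous).completeSpace_coe

/-- The linear bijection of `H¹₀(Ω)` with the energy space. -/
noncomputable def toEnergySpace : H10 Ω →L[ℝ] energySpace Ω T :=
  ((energyMap Ω (T : EuclideanSpace ℝ (Fin N) →L[ℝ] EuclideanSpace ℝ (Fin N))).comp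
    (H10 Ω).subtypeL).codRestrict (energySpace Ω T) fun w => by
      simp only [energySpace, Submodule.mem_comap]
      have := energyMap_energyMap_of_leftInverse (Ω := Ω)
        (T := (T : EuclideanSpace ℝ (Fin N) →L[ℝ] EuclideanSpace ℝ (Fin N)))
        (S := (T.symm : EuclideanSpace ℝ (Fin N) →L[ℝ] EuclideanSpace ℝ (Fin N)))
        (fun x => T.symm_apply_apply x) w.1
      exact this.symm ▸ w.2

/-- The inverse of `toEnergySpace`. -/
noncomputable def ofEnergySpace : energySpace Ω T →L[ℝ] H10 Ω :=
  ((energyMap Ω (T.symm : EuclideanSpace ℝ (Fin N) →L[ℝ] EuclideanSpace ℝ (Fin N))).comp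
    (energySpace Ω T).subtypeL).codRestrict (H10 Ω) fun w => w.2

theorem toEnergySpace_ofEnergySpace (w : energySpace Ω T) :
    toEnergySpace T (ofEnergySpace T w) = w :=
  Subtype.ext (energyMap_energyMap_of_leftInverse (fun x => T.apply_symm_apply x) w.1)

theorem ofEnergySpace_toEnergySpace (w : H10 Ω) :
    ofEnergySpace T (toEnergySpace T w) = w :=
  Subtype.ext (energyMap_energyMap_of_leftInverse (fun x => T.symm_apply_apply x) w.1)

/-- The embedding of the energy space into `L²(Ω)`. -/
noncomputable def energySpaceToL2 : energySpace Ω T →L[ℝ] Lp ℝ 2 (volume.restrict Ω) :=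
  (WithLp.fstL 2 ℝ (Lp ℝ 2 (volume.restrict Ω))
      (Lp (EuclideanSpace ℝ (Fin N)) 2 (volume.restrict Ω))).comp (energySpace Ω T).subtypeL

theorem norm_energySpaceToL2_le (w : energySpace Ω T) : ‖energySpaceToL2 T w‖ ≤ ‖w‖ :=
  WithLp.norm_fst_le _ _

/-- `energyMap` leaves the function component untouched, so this embedding is the Rellich embedding
composed with `ofEnergySpace`. -/
theorem isCompactOperator_energySpaceToL2 (hΩ : MeasurableSet Ω) (hb : Bornology.IsBounded Ω) :
    IsCompactOperator (energySpaceToL2 (Ω := Ω) T) :=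
  (isCompactOperator_fst_H10 hΩ hb).comp_clm (ofEnergySpace T)

theorem inner_toEnergySpace {A : Matrix (Fin N) (Fin N) ℝ}
    (hT : ∀ p q, ⟪T p, T q⟫_ℝ = ∑ i, ∑ j, A i j * p j * q i) (u v : H10 Ω) :
    ⟪toEnergySpace T u, toEnergySpace T v⟫_ℝ =
      (∫ x in Ω, ∑ i, ∑ j, A i j * u.1.snd x j * v.1.snd x i) + ∫ x in Ω, u.1.fst x * v.1.fst x :=
  inner_energyMap hT u.1 v.1

theorem inner_energySpaceToL2 (u v : H10 Ω) :
    ⟪energySpaceToL2 T (toEnergySpace T u), energySpaceToL2 T (toEnergySpace T v)⟫_ℝ =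
      ∫ x in Ω, u.1.fst x * v.1.fst x := by
  rw [L2.inner_def]
  exact integral_congr_ae (Eventually.of_forall fun x => mul_comm _ _)

/-- Adding `∫ u v` to both sides of the weak equation makes the left side the energy inner product;
hence the shift `s + 1`. -/
theorem isWeakEigenSolution_iff {A : Matrix (Fin N) (Fin N) ℝ}
    (hT : ∀ p q, ⟪T p, T q⟫_ℝ = ∑ i, ∑ j, A i j * p j * q i) {s : ℝ} {u : H10 Ω} :
    IsWeakEigenSolution A Ω s u ↔ ∀ v, ⟪toEnergySpace T u, v⟫_ℝ =
      (s + 1) * ⟪energySpaceToL2 T (toEnergySpace T u), energySpaceToL2 T v⟫_ℝ := by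
  constructor
  · intro h v
    rw [← toEnergySpace_ofEnergySpace T v, inner_toEnergySpace T hT, inner_energySpaceToL2, h]
    ring
  · intro h v
    have := h (toEnergySpace T v)
    rw [inner_toEnergySpace T hT, inner_energySpaceToL2] at this
    linarith

end EnergySpace

/-! ### Eigenvalues as min-max values over spaces of test functions. -/

section TestLevels

open scoped InnerProductSpace

variable {N : ℕ}

/-- The space of test functions in `Ω`. -/
def testFunctions (Ω : Set (EuclideanSpace ℝ (Fin N))) :
    Submodule ℝ (EuclideanSpace ℝ (Fin N) → ℝ) where
  carrier := {φ | IsTestFunction Ω φ}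
  add_mem' {φ ψ} hφ hψ := ⟨hφ.smooth.add hψ.smooth, hφ.compact.add hψ.compact,
    (tsupport_add φ ψ).trans (Set.union_subset hφ.support_subset hψ.support_subset)⟩
  zero_mem' := ⟨contDiff_const, HasCompactSupport.zero, by simp [tsupport]⟩
  smul_mem' c φ hφ := ⟨hφ.smooth.const_smul c, hφ.compact.smul_left (f := fun _ => c),
    (closure_mono (Function.support_const_smul_subset c φ)).trans hφ.support_subset⟩

namespace IsTestFunction

variable {Ω : Set (EuclideanSpace ℝ (Fin N))} {φ ψ : EuclideanSpace ℝ (Fin N) → ℝ}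

theorem differentiable (hφ : IsTestFunction Ω φ) : Differentiable ℝ φ :=
  hφ.smooth.differentiable (by simp)

theorem gradient_eq_zero (hφ : IsTestFunction Ω φ) {x : EuclideanSpace ℝ (Fin N)} (hx : x ∉ Ω) :
    ∇ φ x = 0 := by
  have : fderiv ℝ φ x = 0 := by
    by_contra h
    exact hx (hφ.support_subset (support_fderiv_subset ℝ (f := φ) h))
  simp [gradient, this]

theorem eq_zero (hφ : IsTestFunction Ω φ) {x : EuclideanSpace ℝ (Fin N)} (hx : x ∉ Ω) :
    φ x = 0 := by
  by_contra h
  exact hx (hφ.support_subset (subset_tsupport _ h))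

theorem memLp (hφ : IsTestFunction Ω φ) : MemLp φ 2 (volume.restrict Ω) :=
  (hφ.smooth.continuous.memLp_of_hasCompactSupport hφ.compact).restrict Ω

theorem memLp_gradient (hφ : IsTestFunction Ω φ) :
    MemLp (fun x => ∇ φ x) 2 (volume.restrict Ω) := by
  refine ((continuous_gradient (hφ.smooth.of_le (by simp))).memLp_of_hasCompactSupport ?_).restrict Ω
  exact (hφ.compact.fderiv ℝ).comp_left
    (g := (InnerProductSpace.toDual ℝ (EuclideanSpace ℝ (Fin N))).symm) (map_zero _)

end IsTestFunction

/-- The pair `(φ, ∇φ)` of a test function. -/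
noncomputable def testPair (Ω : Set (EuclideanSpace ℝ (Fin N))) :
    testFunctions Ω →ₗ[ℝ] SobolevPair Ω where
  toFun φ := WithLp.toLp 2 ((φ.2 : IsTestFunction Ω φ).memLp.toLp,
    (φ.2 : IsTestFunction Ω φ).memLp_gradient.toLp)
  map_add' φ ψ := by
    refine WithLp.ofLp_injective 2 (Prod.ext ?_ ?_)
    · exact MemLp.toLp_add (φ.2 : IsTestFunction Ω φ).memLp (ψ.2 : IsTestFunction Ω ψ).memLp
    · refine Eq.trans ?_ (MemLp.toLp_add (φ.2 : IsTestFunction Ω φ).memLp_gradient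
        (ψ.2 : IsTestFunction Ω ψ).memLp_gradient)
      refine MemLp.toLp_congr ((φ + ψ).2 : IsTestFunction Ω (φ + ψ).1).memLp_gradient _ (Eventually.of_forall fun x => ?_)
      simp only [gradient, Submodule.coe_add, Pi.add_apply]
      rw [fderiv_add ((φ.2 : IsTestFunction Ω φ).differentiable x)
        ((ψ.2 : IsTestFunction Ω ψ).differentiable x), map_add]
  map_smul' c φ := by
    refine WithLp.ofLp_injective 2 (Prod.ext ?_ ?_)
    · exact MemLp.toLp_const_smul c (φ.2 : IsTestFunction Ω φ).memLp
    · refine Eq.trans ?_ (MemLp.toLp_const_smul c (φ.2 : IsTestFunction Ω φ).memLp_gradient)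
      refine MemLp.toLp_congr ((c • φ).2 : IsTestFunction Ω (c • φ).1).memLp_gradient _ (Eventually.of_forall fun x => ?_)
      simp only [gradient, Submodule.coe_smul, Pi.smul_apply]
      rw [fderiv_const_smul ((φ.2 : IsTestFunction Ω φ).differentiable x), map_smul]

variable {Ω : Set (EuclideanSpace ℝ (Fin N))}

theorem testPair_fst (φ : testFunctions Ω) :
    (testPair Ω φ).fst =ᵐ[volume.restrict Ω] φ.1 :=
  MemLp.coeFn_toLp (φ.2 : IsTestFunction Ω φ).memLp

theorem testPair_snd (φ : testFunctions Ω) :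
    (testPair Ω φ).snd =ᵐ[volume.restrict Ω] fun x => ∇ φ.1 x :=
  MemLp.coeFn_toLp (φ.2 : IsTestFunction Ω φ).memLp_gradient

theorem mem_testPairs_iff {w : SobolevPair Ω} : w ∈ testPairs Ω ↔ ∃ φ, testPair Ω φ = w := by
  constructor
  · rintro ⟨φ, hφ, h1, h2⟩
    refine ⟨⟨φ, hφ⟩, WithLp.ofLp_injective 2 (Prod.ext (Lp.ext ?_) (Lp.ext ?_))⟩
    · exact (testPair_fst ⟨φ, hφ⟩).trans h1.symm
    · exact (testPair_snd ⟨φ, hφ⟩).trans h2.symm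
  · rintro ⟨φ, rfl⟩
    exact ⟨φ, φ.2, testPair_fst φ, testPair_snd φ⟩

/-- The pair `(φ, ∇φ)` as an element of `H¹₀(Ω)`. -/
noncomputable def testH10 (Ω : Set (EuclideanSpace ℝ (Fin N))) : testFunctions Ω →ₗ[ℝ] H10 Ω :=
  (testPair Ω).codRestrict (H10 Ω) fun φ =>
    Submodule.le_topologicalClosure _ (mem_testPairs_iff.mpr ⟨φ, rfl⟩)

theorem denseRange_testH10 : DenseRange (testH10 Ω) := by
  refine Subtype.dense_iff.mpr fun w hw => ?_
  refine closure_mono (fun v hv => ?_) (show w ∈ closure (testPairs Ω : Set _) from hw)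
  obtain ⟨φ, rfl⟩ := mem_testPairs_iff.mp hv
  exact ⟨_, ⟨φ, rfl⟩, rfl⟩

/-- The Dirichlet energy of a function on the whole space. -/
noncomputable def dirichletEnergy (A : Matrix (Fin N) (Fin N) ℝ)
    (f : EuclideanSpace ℝ (Fin N) → ℝ) : ℝ :=
  ∫ x, ∑ i, ∑ j, A i j * ∇ f x j * ∇ f x i

theorem setIntegral_testPair_fst (φ : testFunctions Ω) :
    ∫ x in Ω, (testPair Ω φ).fst x * (testPair Ω φ).fst x = ∫ x, φ.1 x ^ 2 := by
  rw [← setIntegral_eq_integral_of_forall_compl_eq_zero (s := Ω) (f := fun x => φ.1 x ^ 2)]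
  · refine integral_congr_ae ((testPair_fst φ).mono fun x hx => ?_)
    simp only [hx]
    ring
  · intro x hx
    rw [(φ.2 : IsTestFunction Ω φ).eq_zero hx]
    norm_num

theorem setIntegral_testPair_snd (A : Matrix (Fin N) (Fin N) ℝ) (φ : testFunctions Ω) :
    ∫ x in Ω, ∑ i, ∑ j, A i j * (testPair Ω φ).snd x j * (testPair Ω φ).snd x i =
      dirichletEnergy A φ.1 := by
  rw [dirichletEnergy, ← setIntegral_eq_integral_of_forall_compl_eq_zero (s := Ω)
    (f := fun x => ∑ i, ∑ j, A i j * ∇ φ.1 x j * ∇ φ.1 x i)]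
  · refine integral_congr_ae ((testPair_snd φ).mono fun x hx => ?_)
    simp only [hx]
  · intro x hx
    rw [(φ.2 : IsTestFunction Ω φ).gradient_eq_zero hx]
    simp

/-- `t` bounds the Rayleigh quotient on a `k`-dimensional space of test functions in `Ω`. -/
def IsTestLevel (A : Matrix (Fin N) (Fin N) ℝ) (k : ℕ) (Ω : Set (EuclideanSpace ℝ (Fin N)))
    (t : ℝ) : Prop :=
  ∃ φ : Fin k → EuclideanSpace ℝ (Fin N) → ℝ, (∀ i, IsTestFunction Ω (φ i)) ∧
    ∀ c : Fin k → ℝ, c ≠ 0 → 0 < ∫ x, (∑ i, c i • φ i) x ^ 2 ∧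
      dirichletEnergy A (∑ i, c i • φ i) ≤ t * ∫ x, (∑ i, c i • φ i) x ^ 2

/-- Bump functions at `k` distinct points of `Ω`, supported in disjoint neighbourhoods. A
combination vanishing almost everywhere vanishes identically on `Ω` by continuity, and its value at
each point is a coefficient. Dimension at least one makes the open set infinite. -/
theorem exists_linearIndependent_testFunctions (hN : 1 ≤ N) (ho : IsOpen Ω) (hne : Ω.Nonempty)
    (T : EuclideanSpace ℝ (Fin N) ≃L[ℝ] EuclideanSpace ℝ (Fin N)) (k : ℕ) :
    ∃ φ : Fin k → testFunctions Ω, LinearIndependent ℝ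
      fun i => energySpaceToL2 T (toEnergySpace T (testH10 Ω (φ i))) := by
  have : Nonempty (Fin N) := ⟨⟨0, hN⟩⟩
  obtain ⟨y, hy⟩ := hne
  have hinf : Ω.Infinite := infinite_of_mem_nhds y (ho.mem_nhds hy)
  let x : Fin k → EuclideanSpace ℝ (Fin N) := fun i => hinf.natEmbedding _ i
  have hx : ∀ i, x i ∈ Ω := fun i => (hinf.natEmbedding _ i).2
  have hxinj : Function.Injective x := fun i j hij =>
    Fin.ext ((hinf.natEmbedding _).injective (Subtype.ext hij))
  obtain ⟨U, hU, hUd⟩ := (Set.finite_range x).t2_separation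
  choose φ hφs hφc hφ hφr hφ1 using fun i =>
    exists_contDiff_tsupport_subset (s := U (x i) ∩ Ω) (x := x i) (n := ⊤)
      (((hU (x i)).2.inter ho).mem_nhds ⟨(hU (x i)).1, hx i⟩)
  have hφt : ∀ i, IsTestFunction Ω (φ i) := fun i =>
    ⟨hφ i, hφc i, (hφs i).trans Set.inter_subset_right⟩
  have hφ0 : ∀ i j, i ≠ j → φ i (x j) = 0 := by
    intro i j hij
    by_contra h
    have h1 := (hφs i (subset_tsupport _ h)).1
    exact Set.disjoint_left.mp (hUd ⟨i, rfl⟩ ⟨j, rfl⟩ (hxinj.ne hij)) h1 (hU (x j)).1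
  refine ⟨fun i => ⟨φ i, hφt i⟩, Fintype.linearIndependent_iff.mpr fun c hc j => ?_⟩
  set ψ : testFunctions Ω := ∑ i, c i • ⟨φ i, hφt i⟩
  have h1 : energySpaceToL2 T (toEnergySpace T (testH10 Ω ψ)) = 0 := by
    simpa [ψ] using hc
  have h2 : ψ.1 =ᵐ[volume.restrict Ω] fun _ => (0 : ℝ) := by
    refine (testPair_fst ψ).symm.trans ?_
    have h3 : (testPair Ω ψ).fst = 0 := h1
    rw [h3]
    exact Lp.coeFn_zero _ _ _
  have h4 := Measure.eqOn_open_of_ae_eq h2 ho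
    (ψ.2 : IsTestFunction Ω ψ).smooth.continuous.continuousOn continuousOn_const (hx j)
  have h5 : ψ.1 (x j) = c j := by
    simp only [ψ, Submodule.coe_sum, Submodule.coe_smul, Finset.sum_apply, Pi.smul_apply,
      smul_eq_mul]
    rw [Finset.sum_eq_single j (fun i _ hij => by rw [hφ0 i j hij, mul_zero]) (by simp), hφ1,
      mul_one]
  rw [← h5]
  exact h4

set_option maxHeartbeats 1000000 in
/-- The `k`-th Dirichlet eigenvalue exists, and is the min-max value over test functions. -/
theorem exists_isLeast_eigenvalueLevels (hN : 1 ≤ N) (ho : IsOpen Ω) (hne : Ω.Nonempty)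
    (hb : Bornology.IsBounded Ω) {A : Matrix (Fin N) (Fin N) ℝ} (hA : A.PosDef) {k : ℕ}
    (hk : 1 ≤ k) :
    ∃ t : ℝ, 0 ≤ t ∧ IsLeast (eigenvalueLevels A k Ω) t ∧
      (∀ s, IsTestLevel A k Ω s → t ≤ s) ∧ ∀ s, t < s → IsTestLevel A k Ω s := by
  obtain ⟨n, rfl⟩ := Nat.exists_eq_add_of_le' hk
  obtain ⟨T, hT⟩ := hA.exists_continuousLinearEquiv
  have hTinj : Function.Injective (toEnergySpace (Ω := Ω) T) :=
    Function.LeftInverse.injective (ofEnergySpace_toEnergySpace T)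
  have hTsurj : Function.Surjective (toEnergySpace (Ω := Ω) T) :=
    Function.RightInverse.surjective (toEnergySpace_ofEnergySpace T)
  have hdense : Dense (Set.range fun φ => toEnergySpace T (testH10 Ω φ)) :=
    (hTsurj.denseRange.comp denseRange_testH10 (toEnergySpace T).continuous)
  have hJ : ∀ φ : testFunctions Ω, ‖energySpaceToL2 T (toEnergySpace T (testH10 Ω φ))‖ ^ 2 =
      ∫ x, φ.1 x ^ 2 := fun φ => by
    rw [← real_inner_self_eq_norm_sq, inner_energySpaceToL2, ← setIntegral_testPair_fst]
    rfl
  have hE : ∀ φ : testFunctions Ω, ‖toEnergySpace T (testH10 Ω φ)‖ ^ 2 =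
      dirichletEnergy A φ.1 + ∫ x, φ.1 x ^ 2 := fun φ => by
    rw [← real_inner_self_eq_norm_sq, inner_toEnergySpace T hT, ← setIntegral_testPair_fst,
      ← setIntegral_testPair_snd]
    rfl
  have hsum : ∀ (φ : Fin (n + 1) → testFunctions Ω) (c : Fin (n + 1) → ℝ),
      ∑ i, c i • toEnergySpace T (testH10 Ω (φ i)) =
        toEnergySpace T (testH10 Ω (∑ i, c i • φ i)) := fun φ c => by simp
  have hcoe : ∀ (φ : Fin (n + 1) → testFunctions Ω) (c : Fin (n + 1) → ℝ),
      ((∑ i, c i • φ i : testFunctions Ω) : EuclideanSpace ℝ (Fin N) → ℝ) =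
        ∑ i, c i • (φ i : EuclideanSpace ℝ (Fin N) → ℝ) := fun φ c => by simp
  obtain ⟨τ, hτ1, ⟨u, hu, hσ⟩, hmin, happ⟩ :=
    (isCompactOperator_energySpaceToL2 T ho.measurableSet hb).exists_generalized_eigenvalue
      (energySpaceToL2 (Ω := Ω) T) (norm_energySpaceToL2_le T)
      (fun k => by
        obtain ⟨φ, hφ⟩ := exists_linearIndependent_testFunctions hN ho hne T k
        exact ⟨_, hφ⟩) hdense n
  -- The energy norm contains the `L²` norm once, so each generalized eigenvalue exceeds the
  -- Dirichlet eigenvalue by `1`.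
  refine ⟨τ - 1, by linarith, ⟨?_, ?_⟩, ?_, ?_⟩
  · refine ⟨fun i => ofEnergySpace T (u i), ?_, fun i => ?_⟩
    · refine LinearIndependent.of_comp (toEnergySpace (Ω := Ω) T).toLinearMap ?_
      have : (toEnergySpace (Ω := Ω) T).toLinearMap ∘ (fun i => ofEnergySpace T (u i)) = u :=
        funext fun i => toEnergySpace_ofEnergySpace T (u i)
      rwa [this]
    · obtain ⟨σ, hστ, hv⟩ := hσ i
      refine ⟨σ - 1, by linarith, (isWeakEigenSolution_iff T hT).mpr fun v => ?_⟩
      rw [toEnergySpace_ofEnergySpace, hv, sub_add_cancel]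
  · rintro s ⟨w, hw, hs⟩
    choose σ hσs hσw using hs
    have h1 : LinearIndependent ℝ fun i => toEnergySpace T (w i) :=
      hw.map' (toEnergySpace (Ω := Ω) T).toLinearMap (LinearMap.ker_eq_bot.mpr hTinj)
    have h2 := fun i => (isWeakEigenSolution_iff T hT).mp (hσw i)
    have h3 := hmin _ (s + 1) h1 (norm_sq_sum_eigenvectors_le (energySpaceToL2 (Ω := Ω) T)
      (fun i => by linarith [hσs i]) h2)
    linarith
  · rintro s ⟨φ, hφ, h⟩
    let Φ : Fin (n + 1) → testFunctions Ω := fun i => ⟨φ i, hφ i⟩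
    have h2 := hmin (fun i => toEnergySpace T (testH10 Ω (Φ i))) (s + 1) ?_ fun c => ?_
    · linarith
    -- A nontrivial vanishing combination would have zero `L²` norm, against the positivity clause
    -- of `IsTestLevel`.
    · refine Fintype.linearIndependent_iff.mpr fun c hc => ?_
      by_contra hne
      have h3 := (h c (fun h0 => hne fun i => congrFun h0 i)).1
      rw [hsum] at hc
      have h4 := hJ (∑ i, c i • Φ i)
      rw [hc, map_zero, norm_zero, hcoe] at h4
      simp only [Φ] at h4
      linarith
    · rw [hsum, hE, hJ, hcoe]
      by_cases hc : c = 0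
      · simp [hc, dirichletEnergy, gradient]
      · have := (h c hc).2
        simp only [Φ]
        linarith
  · intro s hs
    obtain ⟨w, hw, h⟩ := happ (s + 1) (by linarith)
    choose Φ hΦ using hw
    refine ⟨fun i => Φ i, fun i => (Φ i).2, fun c hc => ?_⟩
    have h1 := h c hc
    simp only [← hΦ] at h1
    rw [hsum, hE, hJ, hcoe] at h1
    exact ⟨h1.1, by linarith [h1.2]⟩

end TestLevels

/-! ### Scaling of test levels and comparison of nearby convex sets. -/

section Continuity

variable {N : ℕ}

theorem integral_comp_smul_add (F : EuclideanSpace ℝ (Fin N) → ℝ) (θ : ℝ)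
    (d : EuclideanSpace ℝ (Fin N)) :
    ∫ x, F (θ • x + d) = |(θ ^ N)⁻¹| * ∫ x, F x := by
  have h := Measure.integral_comp_smul volume (fun x => F (x + d)) θ
  rw [integral_add_right_eq_self, finrank_euclideanSpace_fin, smul_eq_mul] at h
  exact h

theorem gradient_comp_smul_add {f : EuclideanSpace ℝ (Fin N) → ℝ} (hf : Differentiable ℝ f)
    (θ : ℝ) (d x : EuclideanSpace ℝ (Fin N)) :
    ∇ (fun y => f (θ • y + d)) x = θ • ∇ f (θ • x + d) := by
  have h1 : HasFDerivAt (fun y : EuclideanSpace ℝ (Fin N) => θ • y + d)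
      (θ • ContinuousLinearMap.id ℝ (EuclideanSpace ℝ (Fin N))) x :=
    ((hasFDerivAt_id x).const_smul θ).add_const d
  have h2 := ((hf (θ • x + d)).hasFDerivAt.comp x h1).fderiv
  unfold gradient
  rw [← map_smul, ← ContinuousLinearMap.comp_id (fderiv ℝ f (θ • x + d)),
    ← ContinuousLinearMap.comp_smul]
  exact congrArg _ h2

theorem IsTestFunction.comp_smul_add {Ω Ω' : Set (EuclideanSpace ℝ (Fin N))} {θ : ℝ} (hθ : θ ≠ 0)
    {d : EuclideanSpace ℝ (Fin N)} (h : ∀ x, θ • x + d ∈ Ω → x ∈ Ω')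
    {φ : EuclideanSpace ℝ (Fin N) → ℝ} (hφ : IsTestFunction Ω φ) :
    IsTestFunction Ω' fun x => φ (θ • x + d) := by
  refine ⟨hφ.smooth.comp (by fun_prop), ?_, ?_⟩
  · exact hφ.compact.comp_homeomorph ((Homeomorph.smulOfNeZero θ hθ).trans (Homeomorph.addRight d))
  · intro x hx
    refine h x (hφ.support_subset ?_)
    have hc : Continuous fun x : EuclideanSpace ℝ (Fin N) => θ • x + d := by fun_prop
    refine closure_minimal (t := (fun x => θ • x + d) ⁻¹' tsupport φ) (fun y hy => ?_)
      ((isClosed_tsupport φ).preimage hc) hx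
    exact subset_tsupport φ hy

/-- Test levels scale with the square of the ratio under homotheties and translations. -/
theorem IsTestLevel.comp_smul_add {A : Matrix (Fin N) (Fin N) ℝ} {k : ℕ}
    {Ω Ω' : Set (EuclideanSpace ℝ (Fin N))} {θ : ℝ} (hθ : θ ≠ 0) {d : EuclideanSpace ℝ (Fin N)}
    (h : ∀ x, θ • x + d ∈ Ω → x ∈ Ω') {t : ℝ} (ht : IsTestLevel A k Ω t) :
    IsTestLevel A k Ω' (θ ^ 2 * t) := by
  obtain ⟨φ, hφ, hlev⟩ := ht
  refine ⟨fun i x => φ i (θ • x + d), fun i => (hφ i).comp_smul_add hθ h, fun c hc => ?_⟩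
  obtain ⟨h1, h2⟩ := hlev c hc
  have hf : Differentiable ℝ (∑ i, c i • φ i) :=
    Differentiable.sum fun i _ => ((hφ i).differentiable).const_smul (c i)
  set f := ∑ i, c i • φ i
  have hfun : (∑ i, c i • fun x => φ i (θ • x + d)) = fun x => f (θ • x + d) := by
    ext x; simp [f]
  have hpos : 0 < |(θ ^ N)⁻¹| := abs_pos.mpr (inv_ne_zero (pow_ne_zero _ hθ))
  have hE : dirichletEnergy A (fun x => f (θ • x + d)) =
      |(θ ^ N)⁻¹| * (θ ^ 2 * dirichletEnergy A f) := by
    rw [dirichletEnergy, dirichletEnergy, ← integral_const_mul]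
    refine Eq.trans ?_ (integral_comp_smul_add _ θ d)
    refine integral_congr_ae (Eventually.of_forall fun x => ?_)
    simp only [gradient_comp_smul_add hf, PiLp.smul_apply, smul_eq_mul, Finset.mul_sum]
    exact Finset.sum_congr rfl fun i _ => Finset.sum_congr rfl fun j _ => by ring
  rw [hfun, hE, integral_comp_smul_add (fun x => f x ^ 2)]
  refine ⟨mul_pos hpos h1, ?_⟩
  calc |(θ ^ N)⁻¹| * (θ ^ 2 * dirichletEnergy A f)
      ≤ |(θ ^ N)⁻¹| * (θ ^ 2 * (t * ∫ x, f x ^ 2)) := by gcongr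
    _ = _ := by ring

theorem dirichletEigenvalue_eq_coe {A : Matrix (Fin N) (Fin N) ℝ} {k : ℕ}
    {Ω : Set (EuclideanSpace ℝ (Fin N))} {t : ℝ} (h : IsLeast (eigenvalueLevels A k Ω) t) :
    dirichletEigenvalue A k Ω = (t : EReal) :=
  (EReal.coe_strictMono.monotone.map_isLeast h).isGLB.sInf_eq

/-- Comparison of min-max values of two sets, one contained in the `ε`-enlargement of the other. -/
theorem level_le_of_subset_add_ball {A : Matrix (Fin N) (Fin N) ℝ} {k : ℕ}
    {P Q : Set (EuclideanSpace ℝ (Fin N))} (hQ : Convex ℝ Q) {x : EuclideanSpace ℝ (Fin N)}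
    {ρ ε : ℝ} (hρ : 0 < ρ) (hε : 0 < ε) (hball : Metric.ball x ρ ⊆ Q)
    (hPQ : P ⊆ Q + Metric.ball 0 ε) {tP tQ : ℝ} (htP : ∀ s, tP < s → IsTestLevel A k P s)
    (htQ : ∀ s, IsTestLevel A k Q s → tQ ≤ s) : tQ ≤ (1 + ε / ρ) ^ 2 * tP := by
  have hθ : 0 < 1 + ε / ρ := by positivity
  have h1 : ∀ s, tP < s → tQ ≤ (1 + ε / ρ) ^ 2 * s := fun s hs => by
    -- With this `d`, the map `y ↦ θ y + d` is the homothety of centre `x` and ratio `θ`; its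
    -- inverse carries `P` into `Q`, so test functions in `P` pull back to test functions in `Q`.
    refine htQ _ ((htP s hs).comp_smul_add (d := x - (1 + ε / ρ) • x) hθ.ne' fun y hy => ?_)
    have := hQ.homothety_mem_of_subset_add_ball hρ hε hball hPQ hy
    have h2 : (1 + ε / ρ) • y + (x - (1 + ε / ρ) • x) - x = (1 + ε / ρ) • (y - x) := by
      rw [smul_sub]; abel
    rwa [h2, inv_smul_smul₀ hθ.ne', add_sub_cancel] at this
  -- The infimum over test functions need not be attained, so only levels `s > tP` are available and
  -- `s` decreases to `tP`.
  have h2 : tQ / (1 + ε / ρ) ^ 2 ≤ tP := le_of_forall_gt_imp_ge_of_dense fun s hs => by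
    rw [div_le_iff₀ (by positivity), mul_comm]
    exact h1 s hs
  rwa [div_le_iff₀ (by positivity), mul_comm] at h2

end Continuity

/-! ### Existence, boundedness and continuity on the class of convex sets. -/

theorem mainTheorem7 (N : ℕ) (hN : 1 ≤ N) (D : Set (EuclideanSpace ℝ (Fin N)))
    (hD : IsCompact D) (m : ℝ) (hm : 0 < m) (A : Matrix (Fin N) (Fin N) ℝ) (hA : A.PosDef)
    (k : ℕ) (hk : 1 ≤ k) :
    -- the `k`-th eigenvalue is well defined (the infimum is real and is a minimum)
    (∀ Ω ∈ convexClass D m, ∃ t : ℝ,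
      dirichletEigenvalue A k Ω = (t : EReal) ∧ IsLeast (eigenvalueLevels A k Ω) t) ∧
    -- boundedness
    (∃ M : ℝ, ∀ Ω ∈ convexClass D m,
      ((-M : ℝ) : EReal) ≤ dirichletEigenvalue A k Ω ∧
        dirichletEigenvalue A k Ω ≤ (M : EReal)) ∧
    -- continuity
    (∀ (Ωs : ℕ → Set (EuclideanSpace ℝ (Fin N))) (Ω : Set (EuclideanSpace ℝ (Fin N))),
      (∀ n, Ωs n ∈ convexClass D m) → Ω ∈ convexClass D m → UniformlyConverges Ωs Ω →
        Tendsto (fun n => dirichletEigenvalue A k (Ωs n)) atTop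
          (𝓝 (dirichletEigenvalue A k Ω))) := by
  obtain ⟨ρ, hρ, hin⟩ := exists_uniform_inradius hN hD hm
  have hlevel : ∀ Ω : Set (EuclideanSpace ℝ (Fin N)), ∃ t : ℝ, Ω ∈ convexClass D m →
      0 ≤ t ∧ IsLeast (eigenvalueLevels A k Ω) t ∧
      (∀ s, IsTestLevel A k Ω s → t ≤ s) ∧ ∀ s, t < s → IsTestLevel A k Ω s := by
    intro Ω
    by_cases hΩ : Ω ∈ convexClass D m
    · obtain ⟨x, hx⟩ := hin Ω hΩ
      obtain ⟨t, ht⟩ := exists_isLeast_eigenvalueLevels hN hΩ.2.1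
        ⟨x, hx (Metric.mem_ball_self hρ)⟩ (hD.isBounded.subset hΩ.1) hA hk
      exact ⟨t, fun _ => ht⟩
    · exact ⟨0, fun h => absurd h hΩ⟩
  choose t ht using hlevel
  have heq : ∀ Ω ∈ convexClass D m, dirichletEigenvalue A k Ω = (t Ω : EReal) := fun Ω hΩ =>
    dirichletEigenvalue_eq_coe (ht Ω hΩ).2.1
  refine ⟨fun Ω hΩ => ⟨t Ω, heq Ω hΩ, (ht Ω hΩ).2.1⟩, ?_, ?_⟩
  -- `M` is the eigenvalue of the ball of radius `ρ` at the origin, a translate of which lies in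
  -- every `Ω` of the class; the lower bound is `-M ≤ 0 ≤ λ_k`.
  · obtain ⟨M, hM0, -, -, hM⟩ := exists_isLeast_eigenvalueLevels hN
      (Metric.isOpen_ball (x := (0 : EuclideanSpace ℝ (Fin N))) (ε := ρ))
      ⟨0, Metric.mem_ball_self hρ⟩ Metric.isBounded_ball hA hk
    refine ⟨M, fun Ω hΩ => ?_⟩
    obtain ⟨h0, -, hle, -⟩ := ht Ω hΩ
    obtain ⟨x, hx⟩ := hin Ω hΩ
    rw [heq Ω hΩ, EReal.coe_le_coe_iff, EReal.coe_le_coe_iff]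
    refine ⟨by linarith, le_of_forall_gt_imp_ge_of_dense fun s hs => ?_⟩
    have := hle _ ((hM s hs).comp_smul_add (θ := 1) (d := -x) (Ω' := Ω) one_ne_zero fun y hy =>
      hx (by simpa [dist_eq_norm, sub_eq_add_neg] using hy))
    simpa using this
  · intro Ωs Ω hΩs hΩ hconv
    simp only [heq Ω hΩ, fun n => heq (Ωs n) (hΩs n)]
    refine (continuous_coe_real_ereal.tendsto _).comp ?_
    obtain ⟨h0, -, hle, hlt⟩ := ht Ω hΩ
    obtain ⟨x, hx⟩ := hin Ω hΩ
    -- The lower bound shrinks `Ωs n` into `Ω` and uses a ball in `Ω`; the upper bound shrinks `Ω`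
    -- into `Ωs n` and uses a ball in `Ωs n`, so there `ρ` must not depend on `n`.
    have hbound : ∀ ε > 0, ∀ᶠ n in atTop,
        t Ω / (1 + ε / ρ) ^ 2 ≤ t (Ωs n) ∧ t (Ωs n) ≤ (1 + ε / ρ) ^ 2 * t Ω := by
      intro ε hε
      filter_upwards [hconv ε hε] with n hn
      obtain ⟨-, -, hle', hlt'⟩ := ht (Ωs n) (hΩs n)
      obtain ⟨y, hy⟩ := hin (Ωs n) (hΩs n)
      refine ⟨?_, level_le_of_subset_add_ball (hΩs n).2.2.1 hρ hε hy hn.2 hlt hle'⟩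
      rw [div_le_iff₀ (by positivity), mul_comm]
      exact level_le_of_subset_add_ball hΩ.2.2.1 hρ hε hx hn.1 hlt' hle
    have hlow : Tendsto (fun ε : ℝ => t Ω / (1 + ε / ρ) ^ 2) (𝓝[>] 0) (𝓝 (t Ω)) := by
      have : ContinuousAt (fun ε : ℝ => t Ω / (1 + ε / ρ) ^ 2) 0 := by
        refine ContinuousAt.div (by fun_prop) (by fun_prop) (by simp)
      simpa using this.tendsto.mono_left nhdsWithin_le_nhds
    have hupp : Tendsto (fun ε : ℝ => (1 + ε / ρ) ^ 2 * t Ω) (𝓝[>] 0) (𝓝 (t Ω)) := by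
      have : ContinuousAt (fun ε : ℝ => (1 + ε / ρ) ^ 2 * t Ω) 0 := by fun_prop
      simpa using this.tendsto.mono_left nhdsWithin_le_nhds
    rw [tendsto_order]
    constructor
    · intro a ha
      obtain ⟨ε, hε1, hε⟩ := ((hlow.eventually_const_lt ha).and self_mem_nhdsWithin).exists
      filter_upwards [hbound ε hε] with n hn using hε1.trans_le hn.1
    · intro a ha
      obtain ⟨ε, hε1, hε⟩ := ((hupp.eventually_lt_const ha).and self_mem_nhdsWithin).exists
      filter_upwards [hbound ε hε] with n hn using hn.2.trans_lt hε1
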